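/- **Theorem 7.** Let $U\subset\mathbb R^3$ be a non-empty connected open set with coordinates $u=(u^1,u^2,u^3)$, and let $a_i(u^i)$, $b_i(u^i)$ $(i=1,2,3)$ be smooth functions of a single variable. Suppose that on $U$ the numbers $u^1,u^2,u^3$ are pairwise distinct, $a_i(u^i)>0$, and $$M(u)=\frac{b_1(u^1)}{(u^1-u^2)(u^1-u^3)}+\frac{b_2(u^2)}{(u^2-u^1)(u^2-u^3)}+\frac{b_3(u^3)}{(u^3-u^1)(u^3-u^2)}\neq 0 .$$ Consider on $U$ the Riemannian metric $$ds^2=\sum_{i=1}^3H_i^2(du^i)^2,\qquad H_i=\frac1M\,(u^i-u^j)^{-1}(u^i-u^k)^{-1}a_i^{-1/2},\qquad \{i,j,k\}=\{1,2,3\}.$$ Then: 1) The off-diagonal components $R_{ij}$ $(i\ne j)$ of the Ricci tensor of $ds^2$ vanish on $U$. 2) The metric is conformally flat (that is, near each point of $U$ some smooth positive multiple of it has vanishing Riemann curvature tensor) if and only if there are constants $m_i,n_i,p_i$ with $$a_i(u^i)=m_i(u^i)^2+2n_iu^i+p_i\ \text{ on } U\quad(i=1,2,3),\qquad \sum_{i=1}^3m_i=\sum_{i=1}^3n_i=\sum_{i=1}^3p_i=0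 .\tag{$*$}$$ 3) The metric is flat (its Riemann curvature tensor vanishes on $U$) if and only if it is conformally flat and, with constants $m_i,n_i,p_i$ as in $(*)$, there are constants $\alpha_i,\beta_i,\gamma_i$ with $\sum_{i=1}^3\alpha_i=\sum_{i=1}^3\beta_i=\sum_{i=1}^3\gamma_i=0$ such that, on $U$ and for $i=1,2,3$, $$(n_i^2-m_ip_i)\,b_i^2+2\big[(\beta_im_i-\alpha_in_i)u^i+\beta_in_i-\alpha_ip_i\big]b_i+(\alpha_iu^i+\beta_i)^2+\gamma_ia_i=0, \tag{$**$}$$ and such that moreover, for each index $i$ for which $b_i$ does not occur in $(**)$ (that is, $n_i^2-m_ip_i=\beta_im_i-\alpha_in_i=\beta_in_i-\alpha_ip_i=0$), one has $a_ib_i'-\tfrac12a_i'b_i=\alpha_iu^i+\beta_i$ on $U$. -/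

import Mathlib

open scoped ContDiff

noncomputable section

namespace LocalRiemann

/-! Riemannian geometry of a metric `g` given by its component functions in coordinates
`u = (u 0, ..., u (d-1))` on an open subset of `ℝ^d`. -/

/-- The coordinate partial derivative `∂f/∂u^k` at `u`. -/
def pderiv {d : ℕ} (k : Fin d) (f : (Fin d → ℝ) → ℝ) (u : Fin d → ℝ) : ℝ :=
  fderiv ℝ f u (Pi.single k 1)

/-- The Christoffel symbol `Γ^l_{ij}` of the metric `g`. -/
def christoffel {d : ℕ} (g : (Fin d → ℝ) → Matrix (Fin d) (Fin d) ℝ)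
    (l i j : Fin d) (u : Fin d → ℝ) : ℝ :=
  (1 / 2) * ∑ s : Fin d, (g u)⁻¹ l s *
    (pderiv i (fun v => g v j s) u + pderiv j (fun v => g v i s) u - pderiv s (fun v => g v i j) u)

/-- The component `R^l_{kij}` of the Riemann curvature tensor, that is, the `l`-th component of
`R(∂_i, ∂_j) ∂_k`. -/
def riemann {d : ℕ} (g : (Fin d → ℝ) → Matrix (Fin d) (Fin d) ℝ)
    (l k i j : Fin d) (u : Fin d → ℝ) : ℝ :=
  pderiv i (christoffel g l j k) u - pderiv j (christoffel g l i k) u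
    + ∑ s : Fin d, (christoffel g l i s u * christoffel g s j k u
        - christoffel g l j s u * christoffel g s i k u)

/-- The component `R_{ij}` of the Ricci tensor. -/
def ricci {d : ℕ} (g : (Fin d → ℝ) → Matrix (Fin d) (Fin d) ℝ)
    (i j : Fin d) (u : Fin d → ℝ) : ℝ :=
  ∑ l : Fin d, riemann g l i l j u

/-- The metric `g` is flat on `U`: its Riemann curvature tensor vanishes there. -/
def IsFlatOn {d : ℕ} (g : (Fin d → ℝ) → Matrix (Fin d) (Fin d) ℝ) (U : Set (Fin d → ℝ)) : Prop :=
  ∀ u ∈ U, ∀ l k i j : Fin d, riemann g l k i j u = 0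

/-- The metric `g` is conformally flat on `U`: near each point of `U` some smooth positive multiple
of `g` is a flat metric. -/
def IsConformallyFlatOn {d : ℕ} (g : (Fin d → ℝ) → Matrix (Fin d) (Fin d) ℝ)
    (U : Set (Fin d → ℝ)) : Prop :=
  ∀ u ∈ U, ∃ V : Set (Fin d → ℝ), IsOpen V ∧ u ∈ V ∧ V ⊆ U ∧
    ∃ ρ : (Fin d → ℝ) → ℝ, ContDiffOn ℝ ∞ ρ V ∧ (∀ v ∈ V, 0 < ρ v) ∧
      IsFlatOn (fun v => ρ v • g v) V

end LocalRiemann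

namespace DupinMetric

/-- `∏_{j ≠ i} (u^i - u^j)`. -/
def diffProd (i : Fin 3) (u : Fin 3 → ℝ) : ℝ :=
  ∏ j ∈ Finset.univ.erase i, (u i - u j)

/-- `M = ∑_i b_i(u^i) / ∏_{j ≠ i} (u^i - u^j)`. -/
def M (b : Fin 3 → ℝ → ℝ) (u : Fin 3 → ℝ) : ℝ :=
  ∑ i : Fin 3, b i (u i) / diffProd i u

/-- The Lamé coefficient
`H_i = M⁻¹ (u^i - u^j)⁻¹ (u^i - u^k)⁻¹ a_i(u^i)^{-1/2}`, where `{i, j, k} = {1, 2, 3}`. -/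
def lame (a b : Fin 3 → ℝ → ℝ) (i : Fin 3) (u : Fin 3 → ℝ) : ℝ :=
  (M b u)⁻¹ * (diffProd i u)⁻¹ * (Real.sqrt (a i (u i)))⁻¹

/-- The metric `∑_i H_i² (du^i)²`. -/
def metric (a b : Fin 3 → ℝ → ℝ) (u : Fin 3 → ℝ) : Matrix (Fin 3) (Fin 3) ℝ :=
  Matrix.diagonal fun i => lame a b i u ^ 2

/-- On `U`, `a_i(u^i) = m_i (u^i)² + 2 n_i u^i + p_i` with `∑ m_i = ∑ n_i = ∑ p_i = 0`. -/
def IsQuadraticOn (a : Fin 3 → ℝ → ℝ) (U : Set (Fin 3 → ℝ)) (m n p : Fin 3 → ℝ) : Prop :=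
  (∑ i, m i = 0) ∧ (∑ i, n i = 0) ∧ (∑ i, p i = 0) ∧
    ∀ u ∈ U, ∀ i, a i (u i) = m i * u i ^ 2 + 2 * n i * u i + p i

end DupinMetric

end

/-! Up to the factor `M⁻²` the metric is `ĝ = ∑ (du^i)² / (D_i² a_i)` with
`D_i = ∏_{j ≠ i} (u^i - u^j)`, and both parts of the theorem ask when a metric `ψ⁻² ĝ` is flat.
For a diagonal metric in dimension three the curvature tensor consists of the mixed components
`R_{ijik}` and the three sectional curvatures of the coordinate planes
(`isFlatOn_diagonal_iff`). For `ψ⁻² ĝ` the mixed components vanish exactly when `ψ` solves the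
Euler–Poisson–Darboux system `(u^j - u^k) ∂_k ∂_j ψ = ∂_j ψ - ∂_k ψ`. The sum
`M = ∑ b_i / D_i` is a solution of it, and the off-diagonal Ricci components are mixed components,
which gives the first claim. The sectional curvatures vanish exactly when `2 ψ τ_i = |dψ|²` for all
`i`, where `τ_i` are the eigenvalues of `∇²ψ + ψ S` and `S` is the Schouten tensor of `ĝ`
(`isFlatOn_confComp_iff`).

If some multiple of the metric is flat, differentiating `2 ψ τ_i = |dψ|²` in the direction `j`
eliminates `ψ` and leaves the vanishing of the Cotton tensor of `ĝ` (`cotton_eq_zero`), a linear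
equation for the `a_i` alone. One more derivative turns it into the functional equation
`c_i + c_j + c_k = (u^i - u^k) c_i' + (u^j - u^k) c_j'` for `c_i = a_i'`. Differentiating that
equation shows that its solutions are affine with coefficients summing to zero (`exists_affine`),
so the `a_i` are quadratic as claimed (`exists_isQuadraticOn`).

For quadratic `a_i` and `ψ = ∑ b_i / D_i` put `c_i = a_i b_i' - a_i' b_i / 2`. The identities of
`flatDefect_M` show that flatness means that the `c_i` satisfy the same functional equation, hence
`c_i = α_i u^i + β_i`, together with `∑ γ_i = 0` for the first integrals
`γ_i = 2 a_i b_i b_i'' + a_i' b_i b_i' - a_i'' b_i² / 2 - a_i b_i'²`. Eliminating the derivatives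
of `b_i` yields the quadratic relation of the theorem (`quadForm_relation`). Conversely, the
derivative of that relation is a multiple of `c_i = α_i u^i + β_i`; the multiplier can vanish near a
point only if the equation holds there anyway or if `b_i` is absent from the relation
(`wronsk_of_quadratic_relation`).

It remains to find, for quadratic `a_i`, a flat conformal multiple near a point. The functions
`coneFun` solve `c_i = (u^i - v^i) / D_i(v)` with `γ_i = 0` and vanish at `v^i`, so that `ψ` does
not vanish near the given point if `v` differs from that point in exactly one coordinate
(`isConformallyFlatOn_of_isQuadraticOn`). -/

/-! ### Partial derivatives -/

noncomputable section

namespace LocalRiemann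

variable {d : ℕ}

/-- `f` is differentiable at `u` and its `k`-th coordinate partial derivative there is `f'`. -/
def HasPDeriv (k : Fin d) (f : (Fin d → ℝ) → ℝ) (f' : ℝ) (u : Fin d → ℝ) : Prop :=
  DifferentiableAt ℝ f u ∧ pderiv k f u = f'

namespace HasPDeriv

variable {k : Fin d} {f g : (Fin d → ℝ) → ℝ} {f' g' : ℝ} {u : Fin d → ℝ}

theorem of_hasFDerivAt {L : (Fin d → ℝ) →L[ℝ] ℝ} (h : HasFDerivAt f L u) :
    HasPDeriv k f (L (Pi.single k 1)) u :=
  ⟨h.differentiableAt, by rw [pderiv, h.fderiv]⟩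

theorem of_eq (h : HasPDeriv k f f' u) (e : f' = g') : HasPDeriv k f g' u := e ▸ h

theorem unique (h : HasPDeriv k f f' u) (h' : HasPDeriv k f g' u) : f' = g' := by
  rw [← h.2, ← h'.2]

theorem congr_of_eventuallyEq (h : HasPDeriv k f f' u) (e : g =ᶠ[nhds u] f) :
    HasPDeriv k g f' u :=
  ⟨h.1.congr_of_eventuallyEq e, by rw [← h.2, pderiv, pderiv, e.fderiv_eq]⟩

theorem const (k : Fin d) (c : ℝ) (u : Fin d → ℝ) : HasPDeriv k (fun _ => c) 0 u := by
  simpa using of_hasFDerivAt (k := k) (hasFDerivAt_const c u)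

theorem coord (k i : Fin d) (u : Fin d → ℝ) :
    HasPDeriv k (fun v => v i) (if k = i then 1 else 0) u := by
  refine (of_hasFDerivAt (k := k) (hasFDerivAt_apply (𝕜 := ℝ) i u)).of_eq ?_
  simp [Pi.single_apply, eq_comm]

theorem comp {φ : ℝ → ℝ} {φ' : ℝ} (hφ : HasDerivAt φ φ' (f u)) (h : HasPDeriv k f f' u) :
    HasPDeriv k (fun v => φ (f v)) (φ' * f') u := by
  refine (of_hasFDerivAt (k := k) (hφ.comp_hasFDerivAt u h.1.hasFDerivAt)).of_eq ?_
  rw [← h.2, pderiv]; simp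

theorem comp_coord {φ : ℝ → ℝ} {φ' : ℝ} {i : Fin d} (k : Fin d) (hφ : HasDerivAt φ φ' (u i)) :
    HasPDeriv k (fun v => φ (v i)) (if k = i then φ' else 0) u := by
  refine (comp (f := fun v => v i) hφ (coord k i u)).of_eq ?_
  split_ifs <;> simp

theorem add (hf : HasPDeriv k f f' u) (hg : HasPDeriv k g g' u) :
    HasPDeriv k (fun v => f v + g v) (f' + g') u := by
  refine (of_hasFDerivAt (k := k) (hf.1.hasFDerivAt.add hg.1.hasFDerivAt)).of_eq ?_
  rw [← hf.2, ← hg.2, pderiv, pderiv]; simp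

theorem neg (hf : HasPDeriv k f f' u) : HasPDeriv k (fun v => -f v) (-f') u := by
  refine (of_hasFDerivAt (k := k) hf.1.hasFDerivAt.neg).of_eq ?_
  rw [← hf.2, pderiv]; simp

theorem sub (hf : HasPDeriv k f f' u) (hg : HasPDeriv k g g' u) :
    HasPDeriv k (fun v => f v - g v) (f' - g') u := by
  simpa [sub_eq_add_neg] using hf.add hg.neg

theorem mul (hf : HasPDeriv k f f' u) (hg : HasPDeriv k g g' u) :
    HasPDeriv k (fun v => f v * g v) (f' * g u + f u * g') u := by
  refine (of_hasFDerivAt (k := k) (hf.1.hasFDerivAt.mul hg.1.hasFDerivAt)).of_eq ?_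
  rw [← hf.2, ← hg.2, pderiv, pderiv]; simp; ring

theorem const_mul (c : ℝ) (hf : HasPDeriv k f f' u) : HasPDeriv k (fun v => c * f v) (c * f') u :=
  ((const k c u).mul hf).of_eq (by simp)

theorem div_const (hf : HasPDeriv k f f' u) (c : ℝ) : HasPDeriv k (fun v => f v / c) (f' / c) u := by
  simpa [div_eq_inv_mul] using hf.const_mul c⁻¹

theorem pow (hf : HasPDeriv k f f' u) (n : ℕ) :
    HasPDeriv k (fun v => f v ^ n) (n * f u ^ (n - 1) * f') u :=
  comp (hasDerivAt_pow n (f u)) hf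

theorem inv (hf : HasPDeriv k f f' u) (h0 : f u ≠ 0) :
    HasPDeriv k (fun v => (f v)⁻¹) (-f' / f u ^ 2) u :=
  (comp (hasDerivAt_inv h0) hf).of_eq (by ring)

theorem div (hf : HasPDeriv k f f' u) (hg : HasPDeriv k g g' u) (h0 : g u ≠ 0) :
    HasPDeriv k (fun v => f v / g v) ((f' * g u - f u * g') / g u ^ 2) u := by
  simp only [div_eq_mul_inv]
  exact (hf.mul (hg.inv h0)).of_eq (by field_simp; ring)

/-- The partial derivatives of a function vanishing near a point vanish there. -/
theorem eq_zero_of_eqOn {V : Set (Fin d → ℝ)} (hf : HasPDeriv k f f' u) (hV : IsOpen V)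
    (hu : u ∈ V) (h : ∀ v ∈ V, f v = 0) : f' = 0 :=
  hf.unique ((const k 0 u).congr_of_eventuallyEq
    (Filter.eventuallyEq_of_mem (hV.mem_nhds hu) h))

theorem congr_of_eqOn {V : Set (Fin d → ℝ)} (hf : HasPDeriv k f f' u) (hV : IsOpen V)
    (hu : u ∈ V) (h : ∀ v ∈ V, g v = f v) : HasPDeriv k g f' u :=
  hf.congr_of_eventuallyEq (Filter.eventuallyEq_of_mem (hV.mem_nhds hu) h)

end HasPDeriv

/-- A function on a connected open set all of whose partial derivatives vanish is constant. -/
theorem eq_of_hasPDeriv_zero {f : (Fin d → ℝ) → ℝ} {U : Set (Fin d → ℝ)} (hU : IsOpen U)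
    (hUc : IsPreconnected U) (h : ∀ u ∈ U, ∀ k, HasPDeriv k f 0 u) {u v : Fin d → ℝ}
    (hu : u ∈ U) (hv : v ∈ U) (hd : 0 < d) : f u = f v := by
  refine hU.is_const_of_fderiv_eq_zero hUc
    (fun w hw => ((h w hw ⟨0, hd⟩).1).differentiableWithinAt) (fun w hw => ?_) hu hv
  ext x
  rw [show x = ∑ k, x k • (Pi.single k (1 : ℝ) : Fin d → ℝ) from (pi_eq_sum_univ' x)]
  simp only [map_sum, map_smul]
  refine (Finset.sum_eq_zero fun k _ => ?_).trans (by simp)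
  have := (h w hw k).2
  rw [pderiv] at this
  rw [this, smul_zero]

section Smooth

variable {f : (Fin d → ℝ) → ℝ} {u : Fin d → ℝ}

theorem hasPDeriv_of_smooth (k : Fin d) (hf : ContDiffAt ℝ ∞ f u) :
    HasPDeriv k f (pderiv k f u) u :=
  ⟨hf.differentiableAt (by simp), rfl⟩

theorem smooth_pderiv (k : Fin d) (hf : ContDiffAt ℝ ∞ f u) : ContDiffAt ℝ ∞ (pderiv k f) u := by
  have : ContDiffAt ℝ ∞ (fderiv ℝ f) u := hf.fderiv_right (m := ∞) (by simp)
  exact this.clm_apply contDiffAt_const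

theorem pderiv_comm (j k : Fin d) (hf : ContDiffAt ℝ ∞ f u) :
    pderiv j (pderiv k f) u = pderiv k (pderiv j f) u := by
  have h2 : DifferentiableAt ℝ (fderiv ℝ f) u :=
    (hf.fderiv_right (m := ∞) (by simp)).differentiableAt (by simp)
  have hs : IsSymmSndFDerivAt ℝ f u := hf.isSymmSndFDerivAt (by
    rw [minSmoothness_of_isRCLikeNormedField]; exact WithTop.coe_le_coe.2 le_top)
  have e : ∀ l : Fin d, ∀ w, fderiv ℝ (pderiv l f) u w =
      fderiv ℝ (fderiv ℝ f) u w (Pi.single l 1) := by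
    intro l w
    have : HasFDerivAt (pderiv l f) _ u :=
      h2.hasFDerivAt.clm_apply (hasFDerivAt_const (Pi.single l 1 : Fin d → ℝ) u)
    rw [this.fderiv]; simp
  rw [pderiv, pderiv, e, e]
  exact hs _ _

theorem smooth_deriv {φ : ℝ → ℝ} {t : ℝ} (h : ContDiffAt ℝ ∞ φ t) : ContDiffAt ℝ ∞ (deriv φ) t := by
  have : ContDiffAt ℝ ∞ (fderiv ℝ φ) t := h.fderiv_right (m := ∞) (by simp)
  exact this.clm_apply contDiffAt_const

theorem hasDerivAt_of_smooth {φ : ℝ → ℝ} {t : ℝ} (h : ContDiffAt ℝ ∞ φ t) :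
    HasDerivAt φ (deriv φ t) t :=
  (h.differentiableAt (by simp)).hasDerivAt

end Smooth

/-! ### Curvature of diagonal metrics -/

/-- Half the logarithmic derivative `∂_k G_i / (2 G_i)` of a diagonal component of a metric; it
equals `∂_k log H_i` when `G_i = H_i²`. -/
def halfLogDeriv (G : Fin d → (Fin d → ℝ) → ℝ) (k i : Fin d) (u : Fin d → ℝ) : ℝ :=
  pderiv k (G i) u / (2 * G i u)

section Diagonal

variable {G : Fin d → (Fin d → ℝ) → ℝ} {u : Fin d → ℝ}

theorem christoffel_diagonal (h0 : ∀ i, G i u ≠ 0) (l i j : Fin d) :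
    christoffel (fun v => Matrix.diagonal fun i => G i v) l i j u =
      (if j = l then halfLogDeriv G i l u else 0) + (if i = l then halfLogDeriv G j l u else 0)
        - (if i = j then G i u / G l u * halfLogDeriv G l i u else 0) := by
  have hinv : (Matrix.diagonal fun i => G i u)⁻¹ = Matrix.diagonal fun i => (G i u)⁻¹ := by
    apply Matrix.inv_eq_right_inv
    rw [Matrix.diagonal_mul_diagonal, ← Matrix.diagonal_one]
    congr 1; funext i; exact mul_inv_cancel₀ (h0 i)
  have hp : ∀ k i j : Fin d, pderiv k (fun v => Matrix.diagonal (fun i => G i v) i j) u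
      = if i = j then pderiv k (G i) u else 0 := by
    intro k i j
    split_ifs with h
    · subst h; simp
    · simp only [Matrix.diagonal_apply_ne _ h]; exact (HasPDeriv.const k 0 u).2
  rw [christoffel]
  simp only [hinv, hp]
  simp only [Matrix.diagonal_apply, ite_mul, zero_mul, Finset.sum_ite_eq, Finset.mem_univ,
    if_true, halfLogDeriv]
  have hl := h0 l
  have hi := h0 i
  rcases eq_or_ne i j with rfl | h3
  · rcases eq_or_ne i l with rfl | h1
    · simp only [if_true]; field_simp
    · simp only [if_neg h1, if_true]; field_simp; ring
  · rcases eq_or_ne i l with rfl | h1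
    · simp only [if_neg h3, if_neg h3.symm, if_true]; field_simp; ring
    · rcases eq_or_ne j l with rfl | h2
      · simp only [if_neg h3, if_true]; field_simp; ring
      · simp only [if_neg h1, if_neg h2, if_neg h3]; ring

theorem smooth_halfLogDeriv (h0 : ∀ i, G i u ≠ 0) (hG : ∀ i, ContDiffAt ℝ ∞ (G i) u)
    (k i : Fin d) : ContDiffAt ℝ ∞ (halfLogDeriv G k i) u :=
  (smooth_pderiv k (hG i)).div (contDiffAt_const.mul (hG i)) (by simpa using h0 i)

theorem pderiv_halfLogDeriv_comm (h0 : ∀ i, G i u ≠ 0) (hG : ∀ i, ContDiffAt ℝ ∞ (G i) u)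
    (j k i : Fin d) : pderiv j (halfLogDeriv G k i) u = pderiv k (halfLogDeriv G j i) u := by
  have key : ∀ j k : Fin d, pderiv j (halfLogDeriv G k i) u = _ := fun j k =>
    ((hasPDeriv_of_smooth j (smooth_pderiv k (hG i))).div
      ((hasPDeriv_of_smooth j (hG i)).const_mul 2) (by simpa using h0 i)).2
  rw [key, key, pderiv_comm j k (hG i)]
  ring

theorem hasPDeriv_christoffel_diagonal {V : Set (Fin d → ℝ)} (hV : IsOpen V)
    (h0 : ∀ v ∈ V, ∀ i, G i v ≠ 0) (hG : ∀ v ∈ V, ∀ i, ContDiffAt ℝ ∞ (G i) v) (hu : u ∈ V)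
    (k l i j : Fin d) :
    HasPDeriv k (christoffel (fun v => Matrix.diagonal fun i => G i v) l i j)
      ((if j = l then pderiv k (halfLogDeriv G i l) u else 0)
        + (if i = l then pderiv k (halfLogDeriv G j l) u else 0)
        - (if i = j then G i u / G l u *
            (2 * (halfLogDeriv G k i u - halfLogDeriv G k l u) * halfLogDeriv G l i u
              + pderiv k (halfLogDeriv G l i) u) else 0)) u := by
  have hP : ∀ k i, HasPDeriv _ (halfLogDeriv G k i) _ u := fun k' i =>
    hasPDeriv_of_smooth k (smooth_halfLogDeriv (h0 u hu) (hG u hu) k' i)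
  have hite : ∀ (c : Prop) [Decidable c] (f : (Fin d → ℝ) → ℝ) (f' : ℝ), HasPDeriv k f f' u →
      HasPDeriv k (fun v => if c then f v else 0) (if c then f' else 0) u := by
    intro c _ f f' h
    by_cases hc : c
    · simpa [hc] using h
    · simpa [hc] using HasPDeriv.const k 0 u
  have hGG : HasPDeriv k (fun v => G i v / G l v * halfLogDeriv G l i v)
      (G i u / G l u * (2 * (halfLogDeriv G k i u - halfLogDeriv G k l u) * halfLogDeriv G l i u
              + pderiv k (halfLogDeriv G l i) u)) u := by
    refine (((hasPDeriv_of_smooth k (hG u hu i)).div (hasPDeriv_of_smooth k (hG u hu l))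
      (h0 u hu l)).mul (hP l i)).of_eq ?_
    have h1 := h0 u hu i
    have h2 := h0 u hu l
    simp only [halfLogDeriv]
    field_simp
  exact (((hite (j = l) _ _ (hP i l)).add (hite (i = l) _ _ (hP j l))).sub
    (hite (i = j) _ _ hGG)).congr_of_eqOn hV hu
      (fun v hv => christoffel_diagonal (h0 v hv) l i j)

end Diagonal

end LocalRiemann
end

/-! ### The curvature tensor of a diagonal metric in dimension three -/

noncomputable section

namespace LocalRiemann

theorem riemann_self {d : ℕ} (g : (Fin d → ℝ) → Matrix (Fin d) (Fin d) ℝ) (l k i : Fin d)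
    (u : Fin d → ℝ) : riemann g l k i i u = 0 := by
  simp [riemann]

theorem riemann_swap {d : ℕ} (g : (Fin d → ℝ) → Matrix (Fin d) (Fin d) ℝ) (l k i j : Fin d)
    (u : Fin d → ℝ) : riemann g l k j i u = -riemann g l k i j u := by
  simp only [riemann, Finset.sum_sub_distrib]
  ring

theorem sum_three {i j k : Fin 3} (hij : i ≠ j) (hik : i ≠ k) (hjk : j ≠ k) (f : Fin 3 → ℝ) :
    ∑ s, f s = f i + f j + f k := by
  have h : (Finset.univ : Finset (Fin 3)) = {i, j, k} := by revert i j k; decide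
  rw [h, Finset.sum_insert (by simp [hij, hik]), Finset.sum_pair hjk, add_assoc]

/-- The obstruction `∂_k P_{ji} + P_{ki} P_{ji} - P_{kj} P_{ji} - P_{jk} P_{ki}`, where
`P_{ki} = ∂_k log H_i`: up to a factor it is the curvature component `R_{ijik}` of the diagonal
metric `∑ H_i² (du^i)²`. -/
def mixedCurv (G : Fin 3 → (Fin 3 → ℝ) → ℝ) (i j k : Fin 3) (u : Fin 3 → ℝ) : ℝ :=
  pderiv k (halfLogDeriv G j i) u + halfLogDeriv G k i u * halfLogDeriv G j i u
    - halfLogDeriv G k j u * halfLogDeriv G j i u - halfLogDeriv G j k u * halfLogDeriv G k i u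

/-- Minus the sectional curvature of the `(i, j)` coordinate plane of the diagonal metric
`∑ G_i (du^i)²`; `k` is the third index. -/
def planeCurv (G : Fin 3 → (Fin 3 → ℝ) → ℝ) (i j k : Fin 3) (u : Fin 3 → ℝ) : ℝ :=
  (pderiv i (halfLogDeriv G i j) u + halfLogDeriv G i j u ^ 2
      - halfLogDeriv G i i u * halfLogDeriv G i j u) / G i u
    + (pderiv j (halfLogDeriv G j i) u + halfLogDeriv G j i u ^ 2
      - halfLogDeriv G j j u * halfLogDeriv G j i u) / G j u
    + halfLogDeriv G k i u * halfLogDeriv G k j u / G k u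

section Diagonal

variable {G : Fin 3 → (Fin 3 → ℝ) → ℝ} {V : Set (Fin 3 → ℝ)} {u : Fin 3 → ℝ}

theorem riemann_diagonal_eq (hV : IsOpen V)
    (h0 : ∀ v ∈ V, ∀ i, G i v ≠ 0) (hG : ∀ v ∈ V, ∀ i, ContDiffAt ℝ ∞ (G i) v) (hu : u ∈ V)
    {i j k : Fin 3} (hij : i ≠ j) (hik : i ≠ k) (hjk : j ≠ k) :
    let g := fun v => Matrix.diagonal fun i => G i v
    riemann g k k i j u = 0 ∧ riemann g i i i j u = 0 ∧
    riemann g i j i j u = -G j u * planeCurv G i j k u ∧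
    riemann g i k i j u = -mixedCurv G i k j u ∧
    riemann g k i i j u = G i u / G k u * mixedCurv G i k j u := by
  intro g
  have hd := fun k l i j => (hasPDeriv_christoffel_diagonal hV h0 hG hu k l i j).2
  have hc := christoffel_diagonal (h0 u hu)
  have hQ := pderiv_halfLogDeriv_comm (h0 u hu) (hG u hu)
  have hi := h0 u hu i
  have hj := h0 u hu j
  have hk := h0 u hu k
  simp only [g, riemann, hd, hc, sum_three hij hik hjk, planeCurv, mixedCurv, if_true,
    if_neg hij, if_neg hik, if_neg hjk, if_neg hij.symm, if_neg hik.symm, if_neg hjk.symm]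
  refine ⟨?_, ?_, ?_, ?_, ?_⟩
  · linear_combination hQ i j k
  · field_simp
    linear_combination G i u * G j u * G k u * hQ i j i
  · field_simp; ring
  · ring
  · field_simp; ring

theorem ricci_diagonal_offDiag (hV : IsOpen V)
    (h0 : ∀ v ∈ V, ∀ i, G i v ≠ 0) (hG : ∀ v ∈ V, ∀ i, ContDiffAt ℝ ∞ (G i) v) (hu : u ∈ V)
    {i j k : Fin 3} (hij : i ≠ j) (hik : i ≠ k) (hjk : j ≠ k) :
    ricci (fun v => Matrix.diagonal fun i => G i v) i j u = -mixedCurv G k i j u := by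
  rw [ricci, sum_three hij hik hjk,
    (riemann_diagonal_eq hV h0 hG hu hij hik hjk).2.1, riemann_self,
    (riemann_diagonal_eq hV h0 hG hu hjk.symm hik.symm hij.symm).2.2.2.1]
  ring

/-- Every component of the curvature tensor of a diagonal metric in dimension three is, up to a
factor, zero, a mixed component or a sectional curvature of a coordinate plane. -/
theorem isFlatOn_diagonal_iff (hV : IsOpen V)
    (h0 : ∀ v ∈ V, ∀ i, G i v ≠ 0) (hG : ∀ v ∈ V, ∀ i, ContDiffAt ℝ ∞ (G i) v) :
    IsFlatOn (fun v => Matrix.diagonal fun i => G i v) V ↔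
      ∀ v ∈ V, ∀ i j k, i ≠ j → i ≠ k → j ≠ k →
        mixedCurv G i j k v = 0 ∧ planeCurv G i j k v = 0 := by
  constructor
  · intro h v hv i j k hij hik hjk
    obtain ⟨-, -, h3, -, -⟩ := riemann_diagonal_eq hV h0 hG hv hij hik hjk
    obtain ⟨-, -, -, h4, -⟩ := riemann_diagonal_eq hV h0 hG hv hik hij hjk.symm
    rw [h v hv] at h3 h4
    have := h0 v hv j
    exact ⟨by linarith, by simpa [this] using h3.symm⟩
  · intro h v hv l k i j
    rcases eq_or_ne i j with rfl | hij
    · exact riemann_self _ _ _ _ _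
    have third : ∃ m : Fin 3, i ≠ m ∧ j ≠ m := by revert i j; decide
    obtain ⟨m, him, hjm⟩ := third
    have all : ∀ s : Fin 3, s = i ∨ s = j ∨ s = m := by revert i j m; decide
    obtain ⟨a1, a2, a3, a4, a5⟩ := riemann_diagonal_eq hV h0 hG hv hij him hjm
    obtain ⟨b1, b2, b3, b4, b5⟩ := riemann_diagonal_eq hV h0 hG hv hij.symm hjm him
    rw [(h v hv i j m hij him hjm).2, mul_zero] at a3
    rw [(h v hv j i m hij.symm hjm him).2, mul_zero] at b3
    rw [(h v hv i m j him hij hjm.symm).1] at a4 a5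
    rw [(h v hv j m i hjm hij.symm him.symm).1] at b4 b5
    simp only [neg_zero, mul_zero] at a4 a5 b4 b5
    rw [riemann_swap, neg_eq_zero] at b1 b2 b3 b4 b5
    rcases all l with rfl | rfl | rfl <;> rcases all k with rfl | rfl | rfl
    exacts [a2, a3, a4, b3, b2, b4, a5, b5, a1]

end Diagonal

end LocalRiemann
end

/-! ### The conformal class of the metric -/

noncomputable section

namespace DupinMetric

open LocalRiemann

theorem diffProd_eq {i j k : Fin 3} (hij : i ≠ j) (hik : i ≠ k) (hjk : j ≠ k) (u : Fin 3 → ℝ) :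
    diffProd i u = (u i - u j) * (u i - u k) := by
  have h : (Finset.univ : Finset (Fin 3)).erase i = {j, k} := by revert i j k; decide
  rw [diffProd, h, Finset.prod_pair hjk]

/-- The components `1 / (ψ² D_i² a_i)` of the diagonal metric `ψ⁻² ĝ`, where
`ĝ = ∑ (du^i)² / (D_i² a_i)` and `D_i = ∏_{j ≠ i} (u^i - u^j)`. -/
def confComp (a : Fin 3 → ℝ → ℝ) (ψ : (Fin 3 → ℝ) → ℝ) (i : Fin 3) (u : Fin 3 → ℝ) : ℝ :=
  (ψ u ^ 2 * diffProd i u ^ 2 * a i (u i))⁻¹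

/-- The eigenvalue of the Schouten tensor of `ĝ` in the direction `i`; `{i, j, k} = {0, 1, 2}`. -/
def schouten (a : Fin 3 → ℝ → ℝ) (i j k : Fin 3) (u : Fin 3 → ℝ) : ℝ :=
  -(a i (u i) + a j (u j) + a k (u k)) / 2
      * ((u j - u k) ^ 2 - (u i - u j) * (u i - u k))
    + deriv (a i) (u i) / 4 * ((u i - u j) * (u i - u k) * (2 * u i - u j - u k))
    + deriv (a j) (u j) / 4 * ((u j - u i) * (u j - u k) * (u i - u k))
    + deriv (a k) (u k) / 4 * ((u k - u i) * (u k - u j) * (u i - u j))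

/-- The eigenvalue in the direction `i` of `∇²ψ + ψ S`, with the Levi-Civita connection and the
Schouten tensor `S` of `ĝ`. -/
def hessSchouten (a : Fin 3 → ℝ → ℝ) (ψ : (Fin 3 → ℝ) → ℝ) (i j k : Fin 3) (u : Fin 3 → ℝ) : ℝ :=
  ((u i - u j) * (u i - u k)) ^ 2 * a i (u i) * pderiv i (pderiv i ψ) u
    + ((u i - u j) * (u i - u k) * (2 * u i - u j - u k) * a i (u i)
        + ((u i - u j) * (u i - u k)) ^ 2 * deriv (a i) (u i) / 2) * pderiv i ψ u
    + (u i - u j) * (u j - u k) ^ 2 * a j (u j) * pderiv j ψ u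
    + (u i - u k) * (u k - u j) ^ 2 * a k (u k) * pderiv k ψ u
    + ψ u * schouten a i j k u

/-- The squared norm `|dψ|²` with respect to `ĝ`. -/
def gradSq (a : Fin 3 → ℝ → ℝ) (ψ : (Fin 3 → ℝ) → ℝ) (i j k : Fin 3) (u : Fin 3 → ℝ) : ℝ :=
  ((u i - u j) * (u i - u k)) ^ 2 * a i (u i) * pderiv i ψ u ^ 2
    + ((u j - u i) * (u j - u k)) ^ 2 * a j (u j) * pderiv j ψ u ^ 2
    + ((u k - u i) * (u k - u j)) ^ 2 * a k (u k) * pderiv k ψ u ^ 2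

/-- The obstruction `2 ψ τ_i - |dψ|²`, where `τ_i` is the `i`-th eigenvalue of `∇²ψ + ψ S`. It is
twice the `i`-th eigenvalue of the Schouten tensor of `ψ⁻² ĝ`, so that the sum of two of these
obstructions is twice a sectional curvature (`planeCurv_confComp`). -/
def flatDefect (a : Fin 3 → ℝ → ℝ) (ψ : (Fin 3 → ℝ) → ℝ) (i j k : Fin 3) (u : Fin 3 → ℝ) : ℝ :=
  2 * ψ u * hessSchouten a ψ i j k u - gradSq a ψ i j k u

theorem flatDefect_swap (a : Fin 3 → ℝ → ℝ) (ψ : (Fin 3 → ℝ) → ℝ) (i j k : Fin 3)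
    (u : Fin 3 → ℝ) : flatDefect a ψ i k j u = flatDefect a ψ i j k u := by
  simp only [flatDefect, hessSchouten, gradSq, schouten]
  ring

section Curvature

variable {a : Fin 3 → ℝ → ℝ} {ψ : (Fin 3 → ℝ) → ℝ} {V : Set (Fin 3 → ℝ)} {u : Fin 3 → ℝ}

theorem halfLogDeriv_confComp {i j k : Fin 3} (hij : i ≠ j) (hik : i ≠ k) (hjk : j ≠ k)
    (hne : ∀ i j, i ≠ j → u i ≠ u j) (ha : ContDiffAt ℝ ∞ (a i) (u i)) (hpos : 0 < a i (u i))
    (hψ : ContDiffAt ℝ ∞ ψ u) (hψ0 : ψ u ≠ 0) (l : Fin 3) :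
    halfLogDeriv (confComp a ψ) l i u =
      -(pderiv l ψ u / ψ u)
        - ((if l = i then 1 else 0) - (if l = j then 1 else 0)) / (u i - u j)
        - ((if l = i then 1 else 0) - (if l = k then 1 else 0)) / (u i - u k)
        - (if l = i then deriv (a i) (u i) else 0) / (2 * a i (u i)) := by
  have h1 := sub_ne_zero.2 (hne i j hij)
  have h2 := sub_ne_zero.2 (hne i k hik)
  have h3 := hpos.ne'
  have hd : HasPDeriv l (diffProd i) _ u :=
    (((HasPDeriv.coord l i u).sub (HasPDeriv.coord l j u)).mul
      ((HasPDeriv.coord l i u).sub (HasPDeriv.coord l k u))).congr_of_eventuallyEq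
        (Filter.Eventually.of_forall (diffProd_eq hij hik hjk))
  have h0 : ψ u ^ 2 * diffProd i u ^ 2 * a i (u i) ≠ 0 := by
    rw [diffProd_eq hij hik hjk]; positivity
  have := (((((hasPDeriv_of_smooth l hψ).pow 2).mul (hd.pow 2)).mul
    (HasPDeriv.comp_coord l (hasDerivAt_of_smooth ha))).inv h0).2
  rw [halfLogDeriv]
  change pderiv l (fun v => confComp a ψ i v) u = _ at this
  rw [show confComp a ψ i = fun v => confComp a ψ i v from rfl, this]
  simp only [confComp, diffProd_eq hij hik hjk] at h0 ⊢
  generalize (if l = i then (1:ℝ) else 0) = e1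
  generalize (if l = j then (1:ℝ) else 0) = e2
  generalize (if l = k then (1:ℝ) else 0) = e3
  generalize (if l = i then deriv (a i) (u i) else 0) = e4
  push_cast
  field_simp
  ring

theorem smooth_coord (i : Fin 3) : ContDiffAt ℝ ∞ (fun v : Fin 3 → ℝ => v i) u :=
  (contDiff_apply ℝ ℝ i).contDiffAt

theorem smooth_diffProd (i : Fin 3) : ContDiffAt ℝ ∞ (diffProd i) u := by
  unfold diffProd
  exact contDiffAt_prod fun j _ => (smooth_coord i).sub (smooth_coord j)

theorem diffProd_ne_zero (hne : ∀ i j, i ≠ j → u i ≠ u j) (i : Fin 3) : diffProd i u ≠ 0 :=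
  Finset.prod_ne_zero_iff.2 fun j hj => sub_ne_zero.2 (hne i j (Finset.ne_of_mem_erase hj).symm)

theorem confComp_ne_zero (hne : ∀ i j, i ≠ j → u i ≠ u j) (hpos : ∀ i, 0 < a i (u i))
    (hψ0 : ψ u ≠ 0) (i : Fin 3) : confComp a ψ i u ≠ 0 := by
  have := diffProd_ne_zero hne i
  have := (hpos i).ne'
  unfold confComp
  positivity

theorem smooth_confComp (hne : ∀ i j, i ≠ j → u i ≠ u j) (hpos : ∀ i, 0 < a i (u i))
    (ha : ∀ i, ContDiffAt ℝ ∞ (a i) (u i))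
    (hψ : ContDiffAt ℝ ∞ ψ u) (hψ0 : ψ u ≠ 0) (i : Fin 3) : ContDiffAt ℝ ∞ (confComp a ψ i) u := by
  unfold confComp
  refine ContDiffAt.inv (((hψ.pow 2).mul ((smooth_diffProd i).pow 2)).mul
    ((ha i).comp u (smooth_coord i))) ?_
  exact fun h => confComp_ne_zero hne hpos hψ0 i (by rw [confComp, h, inv_zero])

end Curvature

/-- The standing assumptions on the functions `a_i` over an open set `V`: the coordinates are
pairwise distinct, and the `a_i` are smooth and positive. -/
structure Admissible (a : Fin 3 → ℝ → ℝ) (V : Set (Fin 3 → ℝ)) : Prop where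
  isOpen : IsOpen V
  ne : ∀ u ∈ V, ∀ i j, i ≠ j → u i ≠ u j
  pos : ∀ u ∈ V, ∀ i, 0 < a i (u i)
  smooth : ∀ u ∈ V, ∀ i, ContDiffAt ℝ ∞ (a i) (u i)

/-- `ψ` is smooth and nowhere zero on `V`. -/
structure SmoothUnit (ψ : (Fin 3 → ℝ) → ℝ) (V : Set (Fin 3 → ℝ)) : Prop where
  smooth : ∀ u ∈ V, ContDiffAt ℝ ∞ ψ u
  ne_zero : ∀ u ∈ V, ψ u ≠ 0

section Curvature

variable {a : Fin 3 → ℝ → ℝ} {ψ : (Fin 3 → ℝ) → ℝ} {V : Set (Fin 3 → ℝ)} {u : Fin 3 → ℝ}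

theorem halfLogDeriv_confComp_of_ne (hA : Admissible a V) (hψ : SmoothUnit ψ V) (hu : u ∈ V)
    {i j : Fin 3} (hij : i ≠ j) :
    halfLogDeriv (confComp a ψ) j i u = -(pderiv j ψ u / ψ u) + (u i - u j)⁻¹ := by
  obtain ⟨k, hik, hjk⟩ : ∃ k : Fin 3, i ≠ k ∧ j ≠ k := by revert i j; decide
  rw [halfLogDeriv_confComp hij hik hjk (hA.ne u hu) (hA.smooth u hu i) (hA.pos u hu i)
    (hψ.smooth u hu) (hψ.ne_zero u hu)]
  simp only [if_neg hij.symm, if_true, if_neg hjk]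
  ring

theorem halfLogDeriv_confComp_self (hA : Admissible a V) (hψ : SmoothUnit ψ V) (hu : u ∈ V)
    {i j k : Fin 3} (hij : i ≠ j) (hik : i ≠ k) (hjk : j ≠ k) :
    halfLogDeriv (confComp a ψ) i i u = -(pderiv i ψ u / ψ u) - (u i - u j)⁻¹ - (u i - u k)⁻¹
      - deriv (a i) (u i) / (2 * a i (u i)) := by
  rw [halfLogDeriv_confComp hij hik hjk (hA.ne u hu) (hA.smooth u hu i) (hA.pos u hu i)
    (hψ.smooth u hu) (hψ.ne_zero u hu)]
  simp only [if_neg hij, if_true, if_neg hik]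
  ring

theorem pderiv_halfLogDeriv_confComp (hA : Admissible a V) (hψ : SmoothUnit ψ V) (hu : u ∈ V)
    {i j : Fin 3} (hij : i ≠ j) (l : Fin 3) :
    pderiv l (halfLogDeriv (confComp a ψ) j i) u =
      -((pderiv l (pderiv j ψ) u * ψ u - pderiv j ψ u * pderiv l ψ u) / ψ u ^ 2)
        + -((if l = i then 1 else 0) - (if l = j then 1 else 0)) / (u i - u j) ^ 2 :=
  (((((hasPDeriv_of_smooth l (smooth_pderiv j (hψ.smooth u hu))).div
    (hasPDeriv_of_smooth l (hψ.smooth u hu)) (hψ.ne_zero u hu)).neg).add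
      (((HasPDeriv.coord l i u).sub (HasPDeriv.coord l j u)).inv
        (sub_ne_zero.2 (hA.ne u hu i j hij)))).congr_of_eqOn hA.isOpen hu
          (fun _ hv => halfLogDeriv_confComp_of_ne hA hψ hv hij)).2

theorem mixedCurv_confComp (hA : Admissible a V) (hψ : SmoothUnit ψ V) (hu : u ∈ V)
    {i j k : Fin 3} (hij : i ≠ j) (hik : i ≠ k) (hjk : j ≠ k) :
    mixedCurv (confComp a ψ) i j k u =
      -(pderiv k (pderiv j ψ) u - (pderiv j ψ u - pderiv k ψ u) / (u j - u k)) / ψ u := by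
  have h1 := sub_ne_zero.2 (hA.ne u hu i j hij)
  have h2 := sub_ne_zero.2 (hA.ne u hu i k hik)
  have h3 := sub_ne_zero.2 (hA.ne u hu j k hjk)
  have h0 := hψ.ne_zero u hu
  rw [mixedCurv, pderiv_halfLogDeriv_confComp hA hψ hu hij,
    halfLogDeriv_confComp_of_ne hA hψ hu hij, halfLogDeriv_confComp_of_ne hA hψ hu hik,
    halfLogDeriv_confComp_of_ne hA hψ hu hjk, halfLogDeriv_confComp_of_ne hA hψ hu hjk.symm,
    if_neg hik.symm, if_neg hjk.symm, ← neg_sub (u j) (u k)]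
  field_simp
  ring

theorem planeCurv_confComp (hA : Admissible a V) (hψ : SmoothUnit ψ V) (hu : u ∈ V)
    {i j k : Fin 3} (hij : i ≠ j) (hik : i ≠ k) (hjk : j ≠ k) :
    -2 * planeCurv (confComp a ψ) i j k u =
      flatDefect a ψ i j k u + flatDefect a ψ j i k u := by
  have h1 := sub_ne_zero.2 (hA.ne u hu i j hij)
  have h2 := sub_ne_zero.2 (hA.ne u hu i k hik)
  have h3 := sub_ne_zero.2 (hA.ne u hu j k hjk)
  have h0 := hψ.ne_zero u hu
  have ai := (hA.pos u hu i).ne'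
  have aj := (hA.pos u hu j).ne'
  have ak := (hA.pos u hu k).ne'
  rw [planeCurv, pderiv_halfLogDeriv_confComp hA hψ hu hij,
    pderiv_halfLogDeriv_confComp hA hψ hu hij.symm,
    halfLogDeriv_confComp_self hA hψ hu hij hik hjk,
    halfLogDeriv_confComp_self hA hψ hu hij.symm hjk hik,
    halfLogDeriv_confComp_of_ne hA hψ hu hij, halfLogDeriv_confComp_of_ne hA hψ hu hij.symm,
    halfLogDeriv_confComp_of_ne hA hψ hu hik, halfLogDeriv_confComp_of_ne hA hψ hu hjk]
  simp only [if_true, if_neg hij, if_neg hij.symm, confComp, diffProd_eq hij hik hjk,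
    diffProd_eq hij.symm hjk hik, diffProd_eq hik.symm hjk.symm hij, flatDefect, hessSchouten,
    schouten, gradSq, ← neg_sub (u i) (u j), ← neg_sub (u i) (u k), ← neg_sub (u j) (u k)]
  field_simp
  ring

end Curvature

end DupinMetric
end

/-! ### Flatness and the Cotton tensor -/

noncomputable section

namespace DupinMetric

open LocalRiemann

/-- The Euler–Poisson–Darboux system `(u^j - u^k) ∂_k ∂_j ψ = ∂_j ψ - ∂_k ψ` on `V`. -/
def IsEPDOn (ψ : (Fin 3 → ℝ) → ℝ) (V : Set (Fin 3 → ℝ)) : Prop :=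
  ∀ u ∈ V, ∀ j k, j ≠ k → pderiv k (pderiv j ψ) u = (pderiv j ψ u - pderiv k ψ u) / (u j - u k)

section Curvature

variable {a : Fin 3 → ℝ → ℝ} {ψ : (Fin 3 → ℝ) → ℝ} {V : Set (Fin 3 → ℝ)} {u : Fin 3 → ℝ}

/-- Flatness of `ψ⁻² ĝ`: the mixed curvature components give the Euler–Poisson–Darboux system and
the sectional curvatures give the equations `2 ψ τ_i = |dψ|²`. -/
theorem isFlatOn_confComp_iff (hA : Admissible a V) (hψ : SmoothUnit ψ V) :
    IsFlatOn (fun v => Matrix.diagonal fun i => confComp a ψ i v) V ↔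
      IsEPDOn ψ V ∧ ∀ u ∈ V, ∀ i j k, i ≠ j → i ≠ k → j ≠ k → flatDefect a ψ i j k u = 0 := by
  rw [isFlatOn_diagonal_iff hA.isOpen
    (fun v hv => confComp_ne_zero (hA.ne v hv) (hA.pos v hv) (hψ.ne_zero v hv))
    (fun v hv => smooth_confComp (hA.ne v hv) (hA.pos v hv) (hA.smooth v hv) (hψ.smooth v hv)
      (hψ.ne_zero v hv))]
  have hm : ∀ v ∈ V, ∀ i j k, i ≠ j → i ≠ k → j ≠ k → (mixedCurv (confComp a ψ) i j k v = 0 ↔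
      pderiv k (pderiv j ψ) v = (pderiv j ψ v - pderiv k ψ v) / (v j - v k)) := by
    intro v hv i j k hij hik hjk
    rw [mixedCurv_confComp hA hψ hv hij hik hjk, div_eq_zero_iff, neg_eq_zero, sub_eq_zero]
    simp [hψ.ne_zero v hv]
  constructor
  · refine fun h => ⟨fun v hv j k hjk => ?_, fun v hv i j k hij hik hjk => ?_⟩
    · obtain ⟨i, hij, hik⟩ : ∃ i : Fin 3, i ≠ j ∧ i ≠ k := by revert j k; decide
      exact (hm v hv i j k hij hik hjk).1 (h v hv i j k hij hik hjk).1
    · -- `F_i + F_j = F_i + F_k = F_j + F_k = 0` forces `F_i = 0`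
      have e1 := planeCurv_confComp hA hψ hv hij hik hjk
      have e2 := planeCurv_confComp hA hψ hv hik hij hjk.symm
      have e3 := planeCurv_confComp hA hψ hv hjk hij.symm hik.symm
      rw [(h v hv i j k hij hik hjk).2] at e1
      rw [(h v hv i k j hik hij hjk.symm).2, flatDefect_swap] at e2
      rw [(h v hv j k i hjk hij.symm hik.symm).2, flatDefect_swap, flatDefect_swap a ψ k i j] at e3
      linarith
  · rintro ⟨h1, h2⟩ v hv i j k hij hik hjk
    refine ⟨(hm v hv i j k hij hik hjk).2 (h1 v hv j k hjk), ?_⟩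
    have e1 := planeCurv_confComp hA hψ hv hij hik hjk
    rw [h2 v hv i j k hij hik hjk, h2 v hv j i k hij.symm hjk hik] at e1
    linarith

/-- The expression whose vanishing for all indices says that the Cotton tensor of `ĝ` is zero. -/
def cotton (a : Fin 3 → ℝ → ℝ) (i j k : Fin 3) (u : Fin 3 → ℝ) : ℝ :=
  (u i - u k) * (deriv (a i) (u i) - deriv (a k) (u k))
    + (2 * u j - u i - u k) * deriv (a j) (u j)
    + (u i - u j) * (u j - u k) * deriv (deriv (a j)) (u j)
    - 2 * (a i (u i) + a j (u j) + a k (u k))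

/-- The integrability condition of the overdetermined system for `ψ`: conformal flatness kills the
Cotton tensor, which does not involve `ψ`. -/
theorem cotton_eq_zero (hA : Admissible a V) (hψ : SmoothUnit ψ V) (hE : IsEPDOn ψ V)
    (hF : ∀ u ∈ V, ∀ i j k, i ≠ j → i ≠ k → j ≠ k → flatDefect a ψ i j k u = 0) (hu : u ∈ V)
    {i j k : Fin 3} (hij : i ≠ j) (hik : i ≠ k) (hjk : j ≠ k) : cotton a i j k u = 0 := by
  have hs := hψ.smooth u hu
  have hx : HasPDeriv j (fun v => v i) 0 u := (HasPDeriv.coord j i u).of_eq (if_neg hij.symm)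
  have hy : HasPDeriv j (fun v => v j) 1 u := (HasPDeriv.coord j j u).of_eq (if_pos rfl)
  have hz : HasPDeriv j (fun v => v k) 0 u := (HasPDeriv.coord j k u).of_eq (if_neg hjk)
  have ai : HasPDeriv j (fun v => a i (v i)) 0 u :=
    (HasPDeriv.comp_coord j (hasDerivAt_of_smooth (hA.smooth u hu i))).of_eq (if_neg hij.symm)
  have aj : HasPDeriv j (fun v => a j (v j)) (deriv (a j) (u j)) u :=
    (HasPDeriv.comp_coord j (hasDerivAt_of_smooth (hA.smooth u hu j))).of_eq (if_pos rfl)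
  have ak : HasPDeriv j (fun v => a k (v k)) 0 u :=
    (HasPDeriv.comp_coord j (hasDerivAt_of_smooth (hA.smooth u hu k))).of_eq (if_neg hjk)
  have di : HasPDeriv j (fun v => deriv (a i) (v i)) 0 u :=
    (HasPDeriv.comp_coord j (hasDerivAt_of_smooth
      (smooth_deriv (hA.smooth u hu i)))).of_eq (if_neg hij.symm)
  have dj : HasPDeriv j (fun v => deriv (a j) (v j)) (deriv (deriv (a j)) (u j)) u :=
    (HasPDeriv.comp_coord j (hasDerivAt_of_smooth
      (smooth_deriv (hA.smooth u hu j)))).of_eq (if_pos rfl)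
  have dk : HasPDeriv j (fun v => deriv (a k) (v k)) 0 u :=
    (HasPDeriv.comp_coord j (hasDerivAt_of_smooth
      (smooth_deriv (hA.smooth u hu k)))).of_eq (if_neg hjk)
  have p0 := hasPDeriv_of_smooth j hs
  have pi : HasPDeriv j (pderiv i ψ) _ u :=
    (hasPDeriv_of_smooth j (smooth_pderiv i hs)).of_eq (hE u hu i j hij)
  have pj := hasPDeriv_of_smooth j (smooth_pderiv j hs)
  have pk : HasPDeriv j (pderiv k ψ) _ u :=
    (hasPDeriv_of_smooth j (smooth_pderiv k hs)).of_eq (hE u hu k j hjk.symm)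
  have pii : HasPDeriv j (pderiv i (pderiv i ψ)) _ u :=
    (hasPDeriv_of_smooth j (smooth_pderiv i (smooth_pderiv i hs))).of_eq
      ((pderiv_comm j i (smooth_pderiv i hs)).trans
        ((((hasPDeriv_of_smooth i (smooth_pderiv i hs)).sub
          ((hasPDeriv_of_smooth i (smooth_pderiv j hs)).of_eq (hE u hu j i hij.symm))).div
          (((HasPDeriv.coord i i u).of_eq (if_pos rfl)).sub
            ((HasPDeriv.coord i j u).of_eq (if_neg hij))) (sub_ne_zero.2 (hA.ne u hu i j hij))
          ).congr_of_eqOn hA.isOpen hu (fun v hv => hE v hv i j hij)).2)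
  have hS : HasPDeriv j (schouten a i j k) _ u :=
    ((((((ai.add aj).add ak).neg.div_const 2).mul
      (((hy.sub hz).pow 2).sub ((hx.sub hy).mul (hx.sub hz)))).add
      ((di.div_const 4).mul (((hx.sub hy).mul (hx.sub hz)).mul
        (((hx.const_mul 2).sub hy).sub hz)))).add
      ((dj.div_const 4).mul (((hy.sub hx).mul (hy.sub hz)).mul (hx.sub hz)))).add
      ((dk.div_const 4).mul (((hz.sub hx).mul (hz.sub hy)).mul (hx.sub hy)))
  have hH : HasPDeriv j (hessSchouten a ψ i j k) _ u :=
    (((((((hx.sub hy).mul (hx.sub hz)).pow 2).mul ai).mul pii).add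
      ((((((hx.sub hy).mul (hx.sub hz)).mul (((hx.const_mul 2).sub hy).sub hz)).mul ai).add
        (((((hx.sub hy).mul (hx.sub hz)).pow 2).mul di).div_const 2)).mul pi)).add
      ((((hx.sub hy).mul ((hy.sub hz).pow 2)).mul aj).mul pj)).add
      ((((hx.sub hz).mul ((hz.sub hy).pow 2)).mul ak).mul pk) |>.add (p0.mul hS)
  have hG : HasPDeriv j (gradSq a ψ i j k) _ u :=
    ((((((hx.sub hy).mul (hx.sub hz)).pow 2).mul ai).mul (pi.pow 2)).add
      (((((hy.sub hx).mul (hy.sub hz)).pow 2).mul aj).mul (pj.pow 2))).add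
      (((((hz.sub hx).mul (hz.sub hy)).pow 2).mul ak).mul (pk.pow 2))
  have hD : HasPDeriv j (flatDefect a ψ i j k) _ u := ((p0.const_mul 2).mul hH).sub hG
  have e0 := hD.eq_zero_of_eqOn hA.isOpen hu (fun v hv => hF v hv i j k hij hik hjk)
  have e1 := hF u hu i j k hij hik hjk
  have e2 := hF u hu j i k hij.symm hjk hik
  have h1 := sub_ne_zero.2 (hA.ne u hu i j hij)
  have h2 := sub_ne_zero.2 (hA.ne u hu i k hik)
  have h3 := sub_ne_zero.2 (hA.ne u hu j k hjk)
  have h0 := hψ.ne_zero u hu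
  have key : -(u i - u k) / 2 * ψ u ^ 2 * cotton a i j k u = 0 := by
    simp only [flatDefect, hessSchouten, schouten, gradSq] at e0 e1 e2
    rw [cotton]
    push_cast at e0
    rw [← neg_sub (u j) (u k), ← neg_sub (u i) (u j)] at e0
    -- `∂_j F_i + ((u^i - u^j)⁻¹ - ∂_jψ / ψ) (F_i - F_j)` is free of derivatives of `ψ`
    linear_combination (norm := (field_simp; ring)) e0 + ((u i - u j)⁻¹ - pderiv j ψ u / ψ u) * (e1 - e2)
  have h2' : u k - u i ≠ 0 := sub_ne_zero.2 (hA.ne u hu k i hik.symm)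
  simpa [h0, h2'] using key

end Curvature

end DupinMetric
end

/-! ### From the Cotton equation to quadratic functions -/

noncomputable section

namespace DupinMetric

open LocalRiemann

section Affine

variable {c : Fin 3 → ℝ → ℝ} {U : Set (Fin 3 → ℝ)}

/-- The functional equation that both the derivatives `a_i'` and the combinations
`a_i b_i' - a_i' b_i / 2` satisfy in the cases of interest. -/
def AffineEq (c : Fin 3 → ℝ → ℝ) (i j k : Fin 3) (u : Fin 3 → ℝ) : Prop :=
  c i (u i) + c j (u j) + c k (u k) - (u i - u k) * deriv (c i) (u i)
    - (u j - u k) * deriv (c j) (u j) = 0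

theorem affineEq_deriv (hU : IsOpen U) (hne : ∀ u ∈ U, ∀ i j, i ≠ j → u i ≠ u j)
    (hc : ∀ u ∈ U, ∀ i, ContDiffAt ℝ ∞ (c i) (u i))
    (h : ∀ u ∈ U, ∀ i j k, i ≠ j → i ≠ k → j ≠ k → AffineEq c i j k u) {u : Fin 3 → ℝ}
    (hu : u ∈ U) {i j k : Fin 3} (hij : i ≠ j) (hik : i ≠ k) (hjk : j ≠ k) :
    deriv (deriv (c i)) (u i) = 0 ∧
      deriv (c i) (u i) + deriv (c j) (u j) + deriv (c k) (u k) = 0 := by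
  have H : ∀ l, HasPDeriv l (fun v => c i (v i) + c j (v j) + c k (v k)
      - (v i - v k) * deriv (c i) (v i) - (v j - v k) * deriv (c j) (v j)) _ u := fun l =>
    (((HasPDeriv.comp_coord l (hasDerivAt_of_smooth (hc u hu i))).add
      (HasPDeriv.comp_coord l (hasDerivAt_of_smooth (hc u hu j)))).add
      (HasPDeriv.comp_coord l (hasDerivAt_of_smooth (hc u hu k)))).sub
      (((HasPDeriv.coord l i u).sub (HasPDeriv.coord l k u)).mul
        (HasPDeriv.comp_coord l (hasDerivAt_of_smooth (smooth_deriv (hc u hu i))))) |>.sub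
      (((HasPDeriv.coord l j u).sub (HasPDeriv.coord l k u)).mul
        (HasPDeriv.comp_coord l (hasDerivAt_of_smooth (smooth_deriv (hc u hu j)))))
  have hi := (H i).eq_zero_of_eqOn hU hu (fun v hv => h v hv i j k hij hik hjk)
  have hk := (H k).eq_zero_of_eqOn hU hu (fun v hv => h v hv i j k hij hik hjk)
  simp only [if_true, if_neg hij, if_neg hik, if_neg hik.symm, if_neg hjk.symm] at hi hk
  refine ⟨?_, by linarith⟩
  have : (u i - u k) * deriv (deriv (c i)) (u i) = 0 := by linarith
  simpa [sub_ne_zero.2 (hne u hu i k hik)] using this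

theorem exists_affine (hU : IsOpen U) (hUc : IsConnected U)
    (hne : ∀ u ∈ U, ∀ i j, i ≠ j → u i ≠ u j)
    (hc : ∀ u ∈ U, ∀ i, ContDiffAt ℝ ∞ (c i) (u i))
    (h : ∀ u ∈ U, ∀ i j k, i ≠ j → i ≠ k → j ≠ k → AffineEq c i j k u) :
    ∃ α β : Fin 3 → ℝ, ∑ i, α i = 0 ∧ ∑ i, β i = 0 ∧
      ∀ u ∈ U, ∀ i, c i (u i) = α i * u i + β i ∧ deriv (c i) (u i) = α i := by
  obtain ⟨w, hw⟩ := hUc.nonempty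
  have h2 : ∀ u ∈ U, ∀ i, deriv (deriv (c i)) (u i) = 0 := by
    intro u hu i
    obtain ⟨j, k, hij, hik, hjk⟩ : ∃ j k : Fin 3, i ≠ j ∧ i ≠ k ∧ j ≠ k := by revert i; decide
    exact (affineEq_deriv hU hne hc h hu hij hik hjk).1
  have hα : ∀ u ∈ U, ∀ i, deriv (c i) (u i) = deriv (c i) (w i) := by
    intro u hu i
    refine eq_of_hasPDeriv_zero (f := fun v => deriv (c i) (v i)) hU hUc.isPreconnected
      (fun v hv k => ?_) hu hw (by norm_num)
    refine (HasPDeriv.comp_coord k (hasDerivAt_of_smooth (smooth_deriv (hc v hv i)))).of_eq ?_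
    rw [h2 v hv, ite_self]
  have hβ : ∀ u ∈ U, ∀ i, c i (u i) - deriv (c i) (w i) * u i
      = c i (w i) - deriv (c i) (w i) * w i := by
    intro u hu i
    refine eq_of_hasPDeriv_zero (f := fun v => c i (v i) - deriv (c i) (w i) * v i) hU
      hUc.isPreconnected (fun v hv k => ?_) hu hw (by norm_num)
    refine ((HasPDeriv.comp_coord k (hasDerivAt_of_smooth (hc v hv i))).sub
      ((HasPDeriv.coord k i v).const_mul _)).of_eq ?_
    rw [hα v hv]
    split_ifs <;> ring
  have hs := (affineEq_deriv hU hne hc h hw (i := 0) (j := 1) (k := 2) (by decide) (by decide)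
    (by decide)).2
  have hW := h w hw 0 1 2 (by decide) (by decide) (by decide)
  unfold AffineEq at hW
  refine ⟨fun i => deriv (c i) (w i), fun i => c i (w i) - deriv (c i) (w i) * w i, ?_, ?_,
    fun u hu i => ⟨by linarith [hβ u hu i], hα u hu i⟩⟩
  · rw [Fin.sum_univ_three]; exact hs
  · rw [Fin.sum_univ_three]; linear_combination hW - w 2 * hs

end Affine

theorem exists_isQuadraticOn {a : Fin 3 → ℝ → ℝ} {U : Set (Fin 3 → ℝ)} (hA : Admissible a U)
    (hUc : IsConnected U)
    (h : ∀ u ∈ U, ∀ i j k, i ≠ j → i ≠ k → j ≠ k → cotton a i j k u = 0) :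
    ∃ m n p : Fin 3 → ℝ, IsQuadraticOn a U m n p := by
  have hc := fun u hu i => smooth_deriv (hA.smooth u hu i)
  obtain ⟨α, β, hα, hβ, hl⟩ := exists_affine (c := fun i => deriv (a i)) hA.isOpen hUc hA.ne hc
    (by
      intro u hu i j k hij hik hjk
      have H : HasPDeriv i (cotton a i j k) _ u :=
        (((((HasPDeriv.coord i i u).sub (HasPDeriv.coord i k u)).mul
          ((HasPDeriv.comp_coord i (hasDerivAt_of_smooth (hc u hu i))).sub
            (HasPDeriv.comp_coord i (hasDerivAt_of_smooth (hc u hu k))))).add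
          (((((HasPDeriv.coord i j u).const_mul 2).sub (HasPDeriv.coord i i u)).sub
            (HasPDeriv.coord i k u)).mul
              (HasPDeriv.comp_coord i (hasDerivAt_of_smooth (hc u hu j))))).add
          ((((HasPDeriv.coord i i u).sub (HasPDeriv.coord i j u)).mul
            ((HasPDeriv.coord i j u).sub (HasPDeriv.coord i k u))).mul
              (HasPDeriv.comp_coord i (hasDerivAt_of_smooth (smooth_deriv (hc u hu j)))))).sub
          ((((HasPDeriv.comp_coord i (hasDerivAt_of_smooth (hA.smooth u hu i))).add
            (HasPDeriv.comp_coord i (hasDerivAt_of_smooth (hA.smooth u hu j)))).add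
            (HasPDeriv.comp_coord i (hasDerivAt_of_smooth (hA.smooth u hu k)))).const_mul 2)
      have e := H.eq_zero_of_eqOn hA.isOpen hu (fun v hv => h v hv i j k hij hik hjk)
      simp only [if_true, if_neg hij, if_neg hik] at e
      unfold AffineEq
      linarith)
  obtain ⟨w, hw⟩ := hUc.nonempty
  have hp : ∀ u ∈ U, ∀ i, a i (u i) - (α i / 2 * u i ^ 2 + β i * u i)
      = a i (w i) - (α i / 2 * w i ^ 2 + β i * w i) := by
    intro u hu i
    refine eq_of_hasPDeriv_zero (f := fun v => a i (v i) - (α i / 2 * v i ^ 2 + β i * v i))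
      hA.isOpen hUc.isPreconnected (fun v hv k => ?_) hu hw (by norm_num)
    refine ((HasPDeriv.comp_coord k (hasDerivAt_of_smooth (hA.smooth v hv i))).sub
      ((((HasPDeriv.coord k i v).pow 2).const_mul _).add
        ((HasPDeriv.coord k i v).const_mul _))).of_eq ?_
    rw [(hl v hv i).1]
    split_ifs <;> push_cast <;> ring
  refine ⟨fun i => α i / 2, fun i => β i / 2,
    fun i => a i (w i) - (α i / 2 * w i ^ 2 + β i * w i), ?_, ?_, ?_, fun u hu i => ?_⟩
  · rw [← Finset.sum_div, hα, zero_div]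
  · rw [← Finset.sum_div, hβ, zero_div]
  · have h0 := h w hw 0 1 2 (by decide) (by decide) (by decide)
    rw [cotton, (hl w hw 0).1, (hl w hw 1).1, (hl w hw 2).1, (hl w hw 1).2] at h0
    rw [Fin.sum_univ_three] at hα hβ ⊢
    linear_combination -(1 / 2) * h0
      - (w 0 * w 2 / 2) * hα - ((w 0 + w 2) / 2) * hβ
  · linear_combination hp u hu i

end DupinMetric
end

/-! ### The potential built from functions of single coordinates -/

noncomputable section

namespace DupinMetric

open LocalRiemann

section Potential

variable {b : Fin 3 → ℝ → ℝ} {V : Set (Fin 3 → ℝ)} {u : Fin 3 → ℝ}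

theorem M_eq {i j k : Fin 3} (hij : i ≠ j) (hik : i ≠ k) (hjk : j ≠ k) (u : Fin 3 → ℝ) :
    M b u = b i (u i) / ((u i - u j) * (u i - u k)) + b j (u j) / ((u j - u i) * (u j - u k))
      + b k (u k) / ((u k - u i) * (u k - u j)) := by
  rw [M, sum_three hij hik hjk, diffProd_eq hij hik hjk, diffProd_eq hij.symm hjk hik,
    diffProd_eq hik.symm hjk.symm hij]

theorem smooth_M (hne : ∀ i j, i ≠ j → u i ≠ u j) (hb : ∀ i, ContDiffAt ℝ ∞ (b i) (u i)) :
    ContDiffAt ℝ ∞ (M b) u := by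
  unfold M
  exact ContDiffAt.sum fun i _ => ((hb i).comp u (smooth_coord i)).div (smooth_diffProd i)
    (diffProd_ne_zero hne i)

theorem pderiv_M (hne : ∀ i j, i ≠ j → u i ≠ u j) (hb : ∀ i, ContDiffAt ℝ ∞ (b i) (u i))
    {i j k : Fin 3} (hij : i ≠ j) (hik : i ≠ k) (hjk : j ≠ k) :
    pderiv i (M b) u = deriv (b i) (u i) / ((u i - u j) * (u i - u k))
      - b i (u i) * (2 * u i - u j - u k) / ((u i - u j) * (u i - u k)) ^ 2
      + b j (u j) / ((u i - u j) ^ 2 * (u j - u k))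
      - b k (u k) / ((u i - u k) ^ 2 * (u j - u k)) := by
  have h1 := sub_ne_zero.2 (hne i j hij)
  have h2 := sub_ne_zero.2 (hne i k hik)
  have h3 := sub_ne_zero.2 (hne j k hjk)
  have h1' := sub_ne_zero.2 (hne j i hij.symm)
  have h2' := sub_ne_zero.2 (hne k i hik.symm)
  have h3' := sub_ne_zero.2 (hne k j hjk.symm)
  have ci := HasPDeriv.coord i i u
  have cj := HasPDeriv.coord i j u
  have ck := HasPDeriv.coord i k u
  have H := ((((HasPDeriv.comp_coord i (hasDerivAt_of_smooth (hb i))).div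
      ((ci.sub cj).mul (ci.sub ck)) (mul_ne_zero h1 h2)).add
    ((HasPDeriv.comp_coord i (hasDerivAt_of_smooth (hb j))).div
      ((cj.sub ci).mul (cj.sub ck)) (mul_ne_zero h1' h3))).add
    ((HasPDeriv.comp_coord i (hasDerivAt_of_smooth (hb k))).div
      ((ck.sub ci).mul (ck.sub cj)) (mul_ne_zero h2' h3'))).congr_of_eventuallyEq
        (g := M b) (Filter.Eventually.of_forall (M_eq hij hik hjk))
  rw [H.2]
  simp only [if_true, if_neg hij, if_neg hik]
  rw [← neg_sub (u i) (u j), ← neg_sub (u i) (u k), ← neg_sub (u j) (u k)]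
  field_simp
  ring

theorem pderiv_pderiv_M (hV : IsOpen V) (hne : ∀ u ∈ V, ∀ i j, i ≠ j → u i ≠ u j)
    (hb : ∀ u ∈ V, ∀ i, ContDiffAt ℝ ∞ (b i) (u i)) (hu : u ∈ V)
    {i j k : Fin 3} (hij : i ≠ j) (hik : i ≠ k) (hjk : j ≠ k) :
    pderiv i (pderiv i (M b)) u = deriv (deriv (b i)) (u i) / ((u i - u j) * (u i - u k))
      - 2 * deriv (b i) (u i) * (2 * u i - u j - u k) / ((u i - u j) * (u i - u k)) ^ 2
      + 2 * b i (u i) * ((2 * u i - u j - u k) ^ 2 - (u i - u j) * (u i - u k))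
          / ((u i - u j) * (u i - u k)) ^ 3
      - 2 * b j (u j) / ((u i - u j) ^ 3 * (u j - u k))
      + 2 * b k (u k) / ((u i - u k) ^ 3 * (u j - u k)) ∧
    pderiv j (pderiv i (M b)) u = (pderiv i (M b) u - pderiv j (M b) u) / (u i - u j) := by
  have h1 := sub_ne_zero.2 (hne u hu i j hij)
  have h2 := sub_ne_zero.2 (hne u hu i k hik)
  have h3 := sub_ne_zero.2 (hne u hu j k hjk)
  have H : ∀ l, HasPDeriv l (pderiv i (M b)) _ u := fun l =>
    have ci := HasPDeriv.coord l i u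
    have cj := HasPDeriv.coord l j u
    have ck := HasPDeriv.coord l k u
    have bi := HasPDeriv.comp_coord l (hasDerivAt_of_smooth (hb u hu i))
    have bj := HasPDeriv.comp_coord l (hasDerivAt_of_smooth (hb u hu j))
    have bk := HasPDeriv.comp_coord l (hasDerivAt_of_smooth (hb u hu k))
    have di := HasPDeriv.comp_coord l (hasDerivAt_of_smooth (smooth_deriv (hb u hu i)))
    ((((di.div ((ci.sub cj).mul (ci.sub ck)) (mul_ne_zero h1 h2)).sub
      ((bi.mul (((ci.const_mul 2).sub cj).sub ck)).div (((ci.sub cj).mul (ci.sub ck)).pow 2)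
        (pow_ne_zero 2 (mul_ne_zero h1 h2)))).add
      (bj.div (((ci.sub cj).pow 2).mul (cj.sub ck)) (mul_ne_zero (pow_ne_zero 2 h1) h3))).sub
      (bk.div (((ci.sub ck).pow 2).mul (cj.sub ck))
        (mul_ne_zero (pow_ne_zero 2 h2) h3))).congr_of_eqOn hV hu
          (fun v hv => pderiv_M (hne v hv) (hb v hv) hij hik hjk)
  constructor
  · rw [(H i).2]
    simp only [if_true, if_neg hij, if_neg hik]
    push_cast
    field_simp
    ring
  · rw [(H j).2, pderiv_M (hne u hu) (hb u hu) hij hik hjk,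
      pderiv_M (hne u hu) (hb u hu) hij.symm hjk hik]
    simp only [if_true, if_neg hij.symm, if_neg hjk]
    rw [← neg_sub (u i) (u j)]
    push_cast
    field_simp
    ring

theorem isEPDOn_M (hV : IsOpen V) (hne : ∀ u ∈ V, ∀ i j, i ≠ j → u i ≠ u j)
    (hb : ∀ u ∈ V, ∀ i, ContDiffAt ℝ ∞ (b i) (u i)) : IsEPDOn (M b) V := by
  intro u hu i j hij
  obtain ⟨k, hik, hjk⟩ : ∃ k : Fin 3, i ≠ k ∧ j ≠ k := by revert i j; decide
  exact (pderiv_pderiv_M hV hne hb hu hij hik hjk).2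

/-- `a b' - a' b / 2`, which is `a^{3/2} (b / √a)'` where `a > 0`. -/
def wronsk (a b : ℝ → ℝ) (t : ℝ) : ℝ := a t * deriv b t - deriv a t * b t / 2

/-- The quadratic expression `2 a b b'' + a' b b' - a'' b² / 2 - a b'²`, where `a'' = 2 m`; it is
constant when `a` is quadratic and `a b' - a' b / 2` is affine. -/
def quadForm (m : ℝ) (a b : ℝ → ℝ) (t : ℝ) : ℝ :=
  2 * a t * b t * deriv (deriv b) t + deriv a t * b t * deriv b t - m * b t ^ 2
    - a t * deriv b t ^ 2

/-- The left-hand side of `AffineEq` for `c_i = a_i b_i' - a_i' b_i / 2`. -/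
def wronskDefect (m : Fin 3 → ℝ) (a b : Fin 3 → ℝ → ℝ) (i j k : Fin 3) (u : Fin 3 → ℝ) : ℝ :=
  wronsk (a i) (b i) (u i) + wronsk (a j) (b j) (u j) + wronsk (a k) (b k) (u k)
    - (u i - u k) * (a i (u i) * deriv (deriv (b i)) (u i)
        + deriv (a i) (u i) * deriv (b i) (u i) / 2 - m i * b i (u i))
    - (u j - u k) * (a j (u j) * deriv (deriv (b j)) (u j)
        + deriv (a j) (u j) * deriv (b j) (u j) / 2 - m j * b j (u j))

/-- For quadratic `a_i` and `ψ = ∑ b_i / D_i`, the differences of the `τ_i` are multiples of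
`wronskDefect`, and modulo `wronskDefect` every `2 ψ τ_i - |dψ|²` is the sum of the `quadForm`s. -/
theorem flatDefect_M {a : Fin 3 → ℝ → ℝ} {m n p : Fin 3 → ℝ}
    (hV : IsOpen V) (hne : ∀ u ∈ V, ∀ i j, i ≠ j → u i ≠ u j)
    (hb : ∀ u ∈ V, ∀ i, ContDiffAt ℝ ∞ (b i) (u i)) (hu : u ∈ V)
    (hm : ∑ i, m i = 0) (hn : ∑ i, n i = 0) (hp : ∑ i, p i = 0)
    (ha : ∀ i, a i (u i) = m i * u i ^ 2 + 2 * n i * u i + p i)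
    (ha' : ∀ i, deriv (a i) (u i) = 2 * m i * u i + 2 * n i)
    {i j k : Fin 3} (hij : i ≠ j) (hik : i ≠ k) (hjk : j ≠ k) :
    hessSchouten a (M b) i j k u - hessSchouten a (M b) j i k u
      = -(u i - u j) * wronskDefect m a b i j k u ∧
    flatDefect a (M b) i j k u = ∑ l, quadForm (m l) (a l) (b l) (u l)
      + 2 / (u j - u k) * (b j (u j) * wronskDefect m a b i j k u
          - b k (u k) * wronskDefect m a b i k j u) := by
  have h1 := sub_ne_zero.2 (hne u hu i j hij)
  have h2 := sub_ne_zero.2 (hne u hu i k hik)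
  have h3 := sub_ne_zero.2 (hne u hu j k hjk)
  rw [sum_three hij hik hjk] at hm hn hp ⊢
  have e1 : m k = -m i - m j := by linarith
  have e2 : n k = -n i - n j := by linarith
  have e3 : p k = -p i - p j := by linarith
  have pi := pderiv_M (hne u hu) (hb u hu) hij hik hjk
  have pj := pderiv_M (hne u hu) (hb u hu) hij.symm hjk hik
  have pk := pderiv_M (hne u hu) (hb u hu) hik.symm hjk.symm hij
  have pii := (pderiv_pderiv_M hV hne hb hu hij hik hjk).1
  have pjj := (pderiv_pderiv_M hV hne hb hu hij.symm hjk hik).1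
  simp only [flatDefect, gradSq, hessSchouten, schouten, wronskDefect, quadForm, wronsk, pi, pj, pk,
    pii, pjj, M_eq hij hik hjk u, ha, ha', e1, e2, e3,
    ← neg_sub (u i) (u j), ← neg_sub (u i) (u k), ← neg_sub (u j) (u k)]
  generalize deriv (b i) (u i) = b1
  generalize deriv (b j) (u j) = b2
  generalize deriv (b k) (u k) = b3
  generalize deriv (deriv (b i)) (u i) = b4
  generalize deriv (deriv (b j)) (u j) = b5
  generalize deriv (deriv (b k)) (u k) = b6
  generalize b i (u i) = b7
  generalize b j (u j) = b8
  generalize b k (u k) = b9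
  constructor
  · field_simp
    ring
  · field_simp
    ring

end Potential

end DupinMetric
end

/-! ### Congruence of metrics and the equations in one variable -/

noncomputable section

namespace LocalRiemann

open Filter Topology

variable {d : ℕ} {g g' : (Fin d → ℝ) → Matrix (Fin d) (Fin d) ℝ} {V : Set (Fin d → ℝ)}

theorem pderiv_congr (hV : IsOpen V) {f f' : (Fin d → ℝ) → ℝ} (h : ∀ v ∈ V, f v = f' v)
    {u : Fin d → ℝ} (hu : u ∈ V) (k : Fin d) : pderiv k f u = pderiv k f' u := by
  rw [pderiv, pderiv, (eventuallyEq_of_mem (hV.mem_nhds hu) h).fderiv_eq]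

theorem riemann_congr (hV : IsOpen V) (h : ∀ v ∈ V, g v = g' v) {u : Fin d → ℝ} (hu : u ∈ V)
    (l k i j : Fin d) : riemann g l k i j u = riemann g' l k i j u := by
  have hp : ∀ v ∈ V, ∀ k i j, pderiv k (fun w => g w i j) v = pderiv k (fun w => g' w i j) v :=
    fun v hv k i j => pderiv_congr hV (fun w hw => by rw [h w hw]) hv k
  have hc : ∀ l i j, ∀ v ∈ V, christoffel g l i j v = christoffel g' l i j v := by
    intro l i j v hv
    simp only [christoffel, hp v hv, h v hv]
  simp only [riemann, pderiv_congr hV (hc _ _ _) hu, hc _ _ _ u hu]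

theorem isFlatOn_congr (hV : IsOpen V) (h : ∀ v ∈ V, g v = g' v) :
    IsFlatOn g V ↔ IsFlatOn g' V :=
  forall₂_congr fun _ hu => forall₄_congr fun l k i j => by rw [riemann_congr hV h hu]

theorem IsFlatOn.isConformallyFlatOn (hV : IsOpen V) (h : IsFlatOn g V) :
    IsConformallyFlatOn g V := fun u hu =>
  ⟨V, hV, hu, subset_rfl, fun _ => 1, contDiffOn_const, fun _ _ => one_pos, by simpa using h⟩

/-- A property of the `i`-th coordinates of the points of an open set holds near each of these
coordinates. -/
theorem eventually_coord {V : Set (Fin d → ℝ)} (hV : IsOpen V) {u : Fin d → ℝ} (hu : u ∈ V)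
    {i : Fin d} {P : ℝ → Prop} (h : ∀ v ∈ V, P (v i)) : ∀ᶠ t in 𝓝 (u i), P t := by
  have hc : Tendsto (fun t => Function.update u i t) (𝓝 (u i)) (𝓝 u) := by
    have : Continuous fun t => Function.update u i t := continuous_const.update i continuous_id
    simpa using this.tendsto (u i)
  filter_upwards [hc (hV.mem_nhds hu)] with t ht
  simpa using h _ ht

end LocalRiemann

namespace DupinMetric

open LocalRiemann Filter Topology

theorem smul_metric_eq {a b : Fin 3 → ℝ → ℝ} {ψ ρ : (Fin 3 → ℝ) → ℝ} {u : Fin 3 → ℝ}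
    (hpos : ∀ i, 0 < a i (u i)) (hM : M b u ≠ 0) (h : M b u ^ 2 = ρ u * ψ u ^ 2) :
    ρ u • metric a b u = Matrix.diagonal fun i => confComp a ψ i u := by
  rw [metric, ← Matrix.diagonal_smul]
  congr 1
  funext i
  have hρ : ρ u ≠ 0 := fun h0 => hM (by simpa [h0] using h)
  simp only [Pi.smul_apply, smul_eq_mul, lame, confComp, mul_pow, inv_pow,
    Real.sq_sqrt (hpos i).le, h, mul_inv]
  field_simp

section OneVariable

variable {a b : ℝ → ℝ} {t m n p α β γ : ℝ}

theorem deriv_of_quadratic (h : ∀ᶠ s in 𝓝 t, a s = m * s ^ 2 + 2 * n * s + p) :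
    deriv a t = 2 * m * t + 2 * n := by
  rw [EventuallyEq.deriv_eq (f := fun s => m * s ^ 2 + 2 * n * s + p) h]
  have : HasDerivAt (fun s : ℝ => m * s ^ 2 + 2 * n * s + p) _ t :=
    (((hasDerivAt_pow 2 t).const_mul m).add ((hasDerivAt_id t).const_mul (2 * n))).add_const p
  rw [this.deriv]
  push_cast
  ring

theorem smooth_wronsk (ha : ContDiffAt ℝ ∞ a t) (hb : ContDiffAt ℝ ∞ b t) :
    ContDiffAt ℝ ∞ (wronsk a b) t :=
  (ha.mul (smooth_deriv hb)).sub (((smooth_deriv ha).mul hb).div_const 2)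

theorem smooth_quadForm (m : ℝ) (ha : ContDiffAt ℝ ∞ a t) (hb : ContDiffAt ℝ ∞ b t) :
    ContDiffAt ℝ ∞ (quadForm m a b) t :=
  ((((contDiffAt_const.mul ha).mul hb).mul (smooth_deriv (smooth_deriv hb))).add
    (((smooth_deriv ha).mul hb).mul (smooth_deriv hb))).sub (contDiffAt_const.mul (hb.pow 2))
      |>.sub (ha.mul ((smooth_deriv hb).pow 2))

theorem deriv_wronsk (h : ∀ᶠ s in 𝓝 t, a s = m * s ^ 2 + 2 * n * s + p)
    (ha : ContDiffAt ℝ ∞ a t) (hb : ContDiffAt ℝ ∞ b t) :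
    deriv (wronsk a b) t
      = a t * deriv (deriv b) t + deriv a t * deriv b t / 2 - m * b t := by
  have h2 : deriv (deriv a) t = 2 * m := by
    rw [EventuallyEq.deriv_eq (f := fun s => 2 * m * s + 2 * n)
      (h.eventually_nhds.mono fun s hs => deriv_of_quadratic hs)]
    simp
  have := (((hasDerivAt_of_smooth ha).mul (hasDerivAt_of_smooth (smooth_deriv hb))).sub
    (((hasDerivAt_of_smooth (smooth_deriv ha)).mul (hasDerivAt_of_smooth hb)).div_const 2)).deriv
  refine this.trans ?_
  rw [h2]
  ring

/-- The quadratic relation between `a`, `b` and `quadForm`, when `a` is quadratic and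
`a b' - a' b / 2 = α t + β`. -/
theorem quadForm_relation (h : ∀ᶠ s in 𝓝 t, a s = m * s ^ 2 + 2 * n * s + p)
    (hw : ∀ᶠ s in 𝓝 t, wronsk a b s = α * s + β)
    (ha : ContDiffAt ℝ ∞ a t) (hb : ContDiffAt ℝ ∞ b t) :
    (n ^ 2 - m * p) * b t ^ 2 + 2 * ((β * m - α * n) * t + β * n - α * p) * b t
      + (α * t + β) ^ 2 + quadForm m a b t * a t = 0 := by
  have h1 := deriv_of_quadratic h
  have h0 := h.self_of_nhds
  have w0 := hw.self_of_nhds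
  have w1 : a t * deriv (deriv b) t + deriv a t * deriv b t / 2 - m * b t = α := by
    rw [← deriv_wronsk h ha hb, EventuallyEq.deriv_eq (f := fun s => α * s + β) hw]
    simp
  rw [wronsk] at w0
  rw [quadForm]
  rw [h1] at w0 w1 ⊢
  rw [h0] at w0 w1 ⊢
  linear_combination 2 * (m * t ^ 2 + 2 * n * t + p) * b t * w1
    - ((m * t ^ 2 + 2 * n * t + p) * deriv b t + α * t + β + (m * t + n) * b t) * w0

/-- Differentiating the quadratic relation gives the equation `a b' - a' b / 2 = α t + β`
wherever the relation involves `b`. -/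
theorem wronsk_of_quadratic_relation (h : ∀ᶠ s in 𝓝 t, a s = m * s ^ 2 + 2 * n * s + p)
    (ha : ContDiffAt ℝ ∞ a t) (hb : ∀ᶠ s in 𝓝 t, ContDiffAt ℝ ∞ b s)
    (hq : ∀ᶠ s in 𝓝 t, (n ^ 2 - m * p) * b s ^ 2
      + 2 * ((β * m - α * n) * s + β * n - α * p) * b s + (α * s + β) ^ 2 + γ * a s = 0)
    (hdeg : n ^ 2 - m * p = 0 → β * m - α * n = 0 → β * n - α * p = 0 →
      wronsk a b t = α * t + β) : wronsk a b t = α * t + β := by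
  by_contra hne
  have hcont : ContinuousAt (fun s => wronsk a b s - (α * s + β)) t :=
    (smooth_wronsk ha hb.self_of_nhds).continuousAt.sub (by fun_prop)
  have hev := hcont.eventually_ne (sub_ne_zero.2 hne)
  have hz : ∀ᶠ s in 𝓝 t, (n ^ 2 - m * p) * b s + ((β * m - α * n) * s + β * n - α * p) = 0 := by
    filter_upwards [hev, h.eventually_nhds, hb, hq.eventually_nhds] with s hs has hbs hqs
    have e1 := deriv_of_quadratic has
    have e0 := has.self_of_nhds
    have q0 := hqs.self_of_nhds
    have q1 : HasDerivAt (fun s => (n ^ 2 - m * p) * b s ^ 2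
        + 2 * ((β * m - α * n) * s + β * n - α * p) * b s + (α * s + β) ^ 2
        + γ * (m * s ^ 2 + 2 * n * s + p)) _ s :=
      ((((hasDerivAt_of_smooth hbs).pow 2).const_mul (n ^ 2 - m * p)).add
        ((((((hasDerivAt_id s).const_mul (β * m - α * n)).add_const (β * n)).sub_const
          (α * p)).const_mul 2).mul (hasDerivAt_of_smooth hbs))).add
        ((((hasDerivAt_id s).const_mul α).add_const β).pow 2) |>.add
        (((((hasDerivAt_pow 2 s).const_mul m).add ((hasDerivAt_id s).const_mul (2 * n))).add_const
          p).const_mul γ)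
    have q2 := q1.unique ((hasDerivAt_const s (0 : ℝ)).congr_of_eventuallyEq
      (by filter_upwards [has, hqs] with r hr hr'; rw [← hr, hr']))
    have hprod : ((n ^ 2 - m * p) * b s + ((β * m - α * n) * s + β * n - α * p))
        * (wronsk a b s - (α * s + β)) = 0 := by
      rw [wronsk, e1, e0]
      rw [e0] at q0
      push_cast at q2
      simp only [id] at q2
      linear_combination (m * s ^ 2 + 2 * n * s + p) / 2 * q2 - (m * s + n) * q0
    exact (mul_eq_zero.1 hprod).resolve_right hs
  have z0 := hz.self_of_nhds
  have z1 : HasDerivAt (fun s => (n ^ 2 - m * p) * b s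
      + ((β * m - α * n) * s + β * n - α * p)) _ t :=
    ((hasDerivAt_of_smooth hb.self_of_nhds).const_mul (n ^ 2 - m * p)).add
      ((((hasDerivAt_id t).const_mul (β * m - α * n)).add_const (β * n)).sub_const (α * p))
  have z2 := z1.unique ((hasDerivAt_const t (0 : ℝ)).congr_of_eventuallyEq hz)
  by_cases hΔ : n ^ 2 - m * p = 0
  · rw [hΔ] at z0 z2
    have n1 : β * m - α * n = 0 := by linarith
    rw [n1] at z0
    exact hne (hdeg hΔ n1 (by linarith))
  · have : (n ^ 2 - m * p) * (wronsk a b t - (α * t + β)) = 0 := by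
      rw [wronsk, deriv_of_quadratic h, h.self_of_nhds]
      linear_combination (m * t ^ 2 + 2 * n * t + p) * z2 - (m * t + n) * z0
    exact (sub_ne_zero.2 hne) ((mul_eq_zero.1 this).resolve_left hΔ)

end OneVariable

end DupinMetric
end

/-! ### An explicit potential -/

noncomputable section

namespace DupinMetric

open LocalRiemann Filter Topology

/-- The potential `(t - v)² / (w (√a(t) √a(v) + m t v + n (t + v) + p))` attached to
`a = m t² + 2 n t + p`; it solves `a b' - a' b / 2 = (t - v) / w` and has a double zero at `v`. -/
def coneFun (a : ℝ → ℝ) (m n p v w t : ℝ) : ℝ :=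
  (t - v) ^ 2 / (w * (√(a t) * √(a v) + (m * t * v + n * (t + v) + p)))

section ConeFun

variable {a : ℝ → ℝ} {m n p v w t : ℝ}

theorem smooth_coneFun (ha : ContDiffAt ℝ ∞ a t) (hat : 0 < a t) (hw : w ≠ 0)
    (hE : 0 < √(a t) * √(a v) + (m * t * v + n * (t + v) + p)) :
    ContDiffAt ℝ ∞ (coneFun a m n p v w) t := by
  unfold coneFun
  refine ContDiffAt.div (by fun_prop) (contDiffAt_const.mul
    (((ha.sqrt hat.ne').mul contDiffAt_const).add (by fun_prop))) (mul_ne_zero hw hE.ne')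

theorem wronsk_coneFun (h : ∀ᶠ s in 𝓝 t, a s = m * s ^ 2 + 2 * n * s + p)
    (hv : a v = m * v ^ 2 + 2 * n * v + p) (ha : ContDiffAt ℝ ∞ a t) (hat : 0 < a t)
    (hav : 0 ≤ a v) (hw : w ≠ 0) (hE : 0 < √(a t) * √(a v) + (m * t * v + n * (t + v) + p)) :
    wronsk a (coneFun a m n p v w) t = w⁻¹ * t + -(w⁻¹ * v) := by
  have h1 := deriv_of_quadratic h
  have hd := hasDerivAt_of_smooth ha
  have hr : a t = √(a t) ^ 2 := (Real.sq_sqrt hat.le).symm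
  have hr1 : √(a v) ^ 2 = m * v ^ 2 + 2 * n * v + p := by rw [Real.sq_sqrt hav, hv]
  have hr2 : √(a t) ^ 2 = m * t ^ 2 + 2 * n * t + p := by rw [← hr, h.self_of_nhds]
  have hr0 : √(a t) ≠ 0 := (Real.sqrt_pos.2 hat).ne'
  have hb : HasDerivAt (coneFun a m n p v w) _ t :=
    (((hasDerivAt_id t).sub_const v).pow 2).div
      ((((hd.sqrt hat.ne').mul_const (√(a v))).add
        (((((hasDerivAt_id t).const_mul m).mul_const v).add
          (((hasDerivAt_id t).add_const v).const_mul n)).add_const p)).const_mul w)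
      (mul_ne_zero hw hE.ne')
  rw [wronsk, hb.deriv, h1, coneFun]
  simp only [id, Pi.pow_apply] at *
  rw [show a t * _ = √(a t) ^ 2 * _ from congrArg (· * _) hr]
  generalize √(a t) = r at *
  generalize √(a v) = q at *
  have key : (r * q + (m * t * v + n * (t + v) + p)) ^ 2
      = 2 * r ^ 2 * (r * q + (m * t * v + n * (t + v) + p))
        - (t - v) * (r * q * (m * t + n) + r ^ 2 * (m * v + n)
          + (m * t + n) * (r * q + (m * t * v + n * (t + v) + p))) := by
    linear_combination (q ^ 2 - 2 * r * q - 2 * (m * t * v + n * (t + v) + p)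
      + (t - v) * (m * v + n)) * hr2 + (m * t ^ 2 + 2 * n * t + p) * hr1
  have hE' := hE.ne'
  rw [← sub_eq_zero]
  generalize hEE : r * q + (m * t * v + n * (t + v) + p) = E at *
  push_cast
  field_simp
  linear_combination -(t - v) * key

theorem coneFun_relation (ht : a t = m * t ^ 2 + 2 * n * t + p)
    (hv : a v = m * v ^ 2 + 2 * n * v + p) (hat : 0 ≤ a t) (hav : 0 ≤ a v) (hw : w ≠ 0)
    (hE : 0 < √(a t) * √(a v) + (m * t * v + n * (t + v) + p)) :
    (n ^ 2 - m * p) * coneFun a m n p v w t ^ 2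
      + 2 * ((-(w⁻¹ * v) * m - w⁻¹ * n) * t + -(w⁻¹ * v) * n - w⁻¹ * p) * coneFun a m n p v w t
      + (w⁻¹ * t + -(w⁻¹ * v)) ^ 2 = 0 := by
  have hr1 : √(a v) ^ 2 = m * v ^ 2 + 2 * n * v + p := by rw [Real.sq_sqrt hav, hv]
  have hr2 : √(a t) ^ 2 = m * t ^ 2 + 2 * n * t + p := by rw [Real.sq_sqrt hat, ht]
  rw [coneFun]
  have hE' := hE.ne'
  generalize √(a t) = r at *
  generalize √(a v) = q at *
  field_simp
  linear_combination (t - v) ^ 2 * (q ^ 2 * hr2 + (m * t ^ 2 + 2 * n * t + p) * hr1)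

end ConeFun

end DupinMetric
end

/-! ### Criteria of flatness and of conformal flatness -/

noncomputable section

namespace DupinMetric

open LocalRiemann Filter Topology

section Flatness

variable {a b : Fin 3 → ℝ → ℝ} {V : Set (Fin 3 → ℝ)} {m n p α β : Fin 3 → ℝ}

theorem IsQuadraticOn.eventually (hq : IsQuadraticOn a V m n p) (hV : IsOpen V) {u : Fin 3 → ℝ}
    (hu : u ∈ V) (i : Fin 3) : ∀ᶠ s in 𝓝 (u i), a i s = m i * s ^ 2 + 2 * n i * s + p i :=
  eventually_coord hV hu fun v hv => hq.2.2.2 v hv i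

theorem wronskDefect_eq_zero_iff (hA : Admissible a V) (hq : IsQuadraticOn a V m n p)
    {u : Fin 3 → ℝ} (hu : u ∈ V) (hb : ∀ i, ContDiffAt ℝ ∞ (b i) (u i)) (i j k : Fin 3) :
    wronskDefect m a b i j k u = 0 ↔ AffineEq (fun i => wronsk (a i) (b i)) i j k u := by
  have hd := fun i => deriv_wronsk (hq.eventually hA.isOpen hu i) (hA.smooth u hu i) (hb i)
  rw [AffineEq, hd, hd, wronskDefect]

/-- If `a` satisfies the quadratic condition, `ψ = ∑ b_i / D_i` makes `ψ⁻² ĝ` flat as soon as the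
`a_i b_i' - a_i' b_i / 2` are affine with coefficients summing to zero and the quadratic
invariants of the `b_i` sum to zero. -/
theorem isFlatOn_of_wronsk (hA : Admissible a V) (hq : IsQuadraticOn a V m n p)
    (hb : ∀ u ∈ V, ∀ i, ContDiffAt ℝ ∞ (b i) (u i)) (hM : ∀ u ∈ V, M b u ≠ 0)
    (hα : ∑ i, α i = 0) (hβ : ∑ i, β i = 0)
    (hw : ∀ u ∈ V, ∀ i, wronsk (a i) (b i) (u i) = α i * u i + β i)
    (hQ : ∀ u ∈ V, ∑ i, quadForm (m i) (a i) (b i) (u i) = 0) :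
    IsFlatOn (fun v => Matrix.diagonal fun i => confComp a (M b) i v) V := by
  rw [isFlatOn_confComp_iff hA ⟨fun u hu => smooth_M (hA.ne u hu) (hb u hu), hM⟩]
  refine ⟨isEPDOn_M hA.isOpen hA.ne hb, fun u hu i j k hij hik hjk => ?_⟩
  have hW : ∀ i j k, i ≠ j → i ≠ k → j ≠ k → wronskDefect m a b i j k u = 0 := by
    intro i j k hij hik hjk
    have hd : ∀ i, deriv (wronsk (a i) (b i)) (u i) = α i := by
      intro i
      rw [EventuallyEq.deriv_eq (f := fun s => α i * s + β i)
        (eventually_coord hA.isOpen hu fun v hv => hw v hv i)]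
      simp
    rw [wronskDefect_eq_zero_iff hA hq hu (hb u hu), AffineEq, hd, hd, hw u hu, hw u hu, hw u hu]
    rw [sum_three hij hik hjk] at hα hβ
    linear_combination u k * hα + hβ
  rw [(flatDefect_M hA.isOpen hA.ne hb hu hq.1 hq.2.1 hq.2.2.1 (hq.2.2.2 u hu)
    (fun i => deriv_of_quadratic (hq.eventually hA.isOpen hu i)) hij hik hjk).2, hQ u hu,
    hW i j k hij hik hjk, hW i k j hik hij hjk.symm]
  ring

/-- The converse of `isFlatOn_of_wronsk`. -/
theorem wronsk_of_isFlatOn (hA : Admissible a V) (hVc : IsConnected V)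
    (hq : IsQuadraticOn a V m n p)
    (hb : ∀ u ∈ V, ∀ i, ContDiffAt ℝ ∞ (b i) (u i)) (hM : ∀ u ∈ V, M b u ≠ 0)
    (h : IsFlatOn (fun v => Matrix.diagonal fun i => confComp a (M b) i v) V) :
    (∃ α β : Fin 3 → ℝ, ∑ i, α i = 0 ∧ ∑ i, β i = 0 ∧
      ∀ u ∈ V, ∀ i, wronsk (a i) (b i) (u i) = α i * u i + β i) ∧
    ∀ u ∈ V, ∑ i, quadForm (m i) (a i) (b i) (u i) = 0 := by
  rw [isFlatOn_confComp_iff hA ⟨fun u hu => smooth_M (hA.ne u hu) (hb u hu), hM⟩] at h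
  have hF := fun u (hu : u ∈ V) i j k (hij : i ≠ j) (hik : i ≠ k) (hjk : j ≠ k) =>
    flatDefect_M hA.isOpen hA.ne hb hu hq.1 hq.2.1 hq.2.2.1 (hq.2.2.2 u hu)
      (fun i => deriv_of_quadratic (hq.eventually hA.isOpen hu i)) hij hik hjk
  have hW : ∀ u ∈ V, ∀ i j k, i ≠ j → i ≠ k → j ≠ k → wronskDefect m a b i j k u = 0 := by
    intro u hu i j k hij hik hjk
    have e1 := h.2 u hu i j k hij hik hjk
    have e2 := h.2 u hu j i k hij.symm hjk hik
    have e3 := (hF u hu i j k hij hik hjk).1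
    have e4 : gradSq a (M b) j i k u = gradSq a (M b) i j k u := by rw [gradSq, gradSq]; ring
    rw [flatDefect] at e1 e2
    have e5 : 2 * M b u * ((u i - u j) * wronskDefect m a b i j k u) = 0 := by
      linear_combination -(e1 - e2) + 2 * M b u * e3 + e4
    simpa [hM u hu, sub_ne_zero.2 (hA.ne u hu i j hij)] using e5
  refine ⟨?_, fun u hu => ?_⟩
  · obtain ⟨α, β, hα, hβ, hl⟩ := exists_affine (c := fun i => wronsk (a i) (b i)) hA.isOpen hVc
      hA.ne (fun u hu i => smooth_wronsk (hA.smooth u hu i) (hb u hu i))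
      (fun u hu i j k hij hik hjk =>
        (wronskDefect_eq_zero_iff hA hq hu (hb u hu) i j k).1 (hW u hu i j k hij hik hjk))
    exact ⟨α, β, hα, hβ, fun u hu i => (hl u hu i).1⟩
  · have e := (hF u hu 0 1 2 (by decide) (by decide) (by decide)).2
    rw [h.2 u hu 0 1 2 (by decide) (by decide) (by decide),
      hW u hu 0 1 2 (by decide) (by decide) (by decide),
      hW u hu 0 2 1 (by decide) (by decide) (by decide)] at e
    linarith

/-- A sum of functions of the single coordinates that vanishes on a connected open set consists of
constants. -/
theorem exists_const_of_sum_eq_zero {f : Fin 3 → ℝ → ℝ} (hV : IsOpen V) (hVc : IsConnected V)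
    (hf : ∀ u ∈ V, ∀ i, ContDiffAt ℝ ∞ (f i) (u i)) (h : ∀ u ∈ V, ∑ i, f i (u i) = 0) :
    ∃ γ : Fin 3 → ℝ, ∑ i, γ i = 0 ∧ ∀ u ∈ V, ∀ i, f i (u i) = γ i := by
  obtain ⟨w, hw⟩ := hVc.nonempty
  refine ⟨fun i => f i (w i), h w hw, fun u hu i => ?_⟩
  refine eq_of_hasPDeriv_zero (f := fun v => f i (v i)) hV hVc.isPreconnected
    (fun v hv l => ?_) hu hw (by norm_num)
  have hc := fun i => HasPDeriv.comp_coord l (hasDerivAt_of_smooth (hf v hv i))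
  refine (hc i).of_eq ?_
  split_ifs with hl
  · subst hl
    have := (((hc 0).add (hc 1)).add (hc 2)).eq_zero_of_eqOn hV hv
      (fun v hv => by rw [← Fin.sum_univ_three fun i => f i (v i)]; exact h v hv)
    rw [← Fin.sum_univ_three fun i => if l = i then deriv (f i) (v i) else 0] at this
    simpa using this
  · rfl

end Flatness

section ConformallyFlat

variable {a b : Fin 3 → ℝ → ℝ} {U : Set (Fin 3 → ℝ)} {m n p : Fin 3 → ℝ}

theorem cotton_of_isConformallyFlatOn (hA : Admissible a U)
    (hb : ∀ u ∈ U, ∀ i, ContDiffAt ℝ ∞ (b i) (u i)) (hM : ∀ u ∈ U, M b u ≠ 0)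
    (h : IsConformallyFlatOn (metric a b) U) {u : Fin 3 → ℝ} (hu : u ∈ U) {i j k : Fin 3}
    (hij : i ≠ j) (hik : i ≠ k) (hjk : j ≠ k) : cotton a i j k u = 0 := by
  obtain ⟨V, hV, huV, hVU, ρ, hρ, hρ0, hflat⟩ := h u hu
  have hAV : Admissible a V := ⟨hV, fun v hv => hA.ne v (hVU hv), fun v hv => hA.pos v (hVU hv),
    fun v hv => hA.smooth v (hVU hv)⟩
  have hψ : SmoothUnit (fun v => M b v / √(ρ v)) V := by
    refine ⟨fun v hv => ?_, fun v hv => ?_⟩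
    · exact (smooth_M (hA.ne v (hVU hv)) (hb v (hVU hv))).div
        ((hρ.contDiffAt (hV.mem_nhds hv)).sqrt (hρ0 v hv).ne') (Real.sqrt_pos.2 (hρ0 v hv)).ne'
    · exact div_ne_zero (hM v (hVU hv)) (Real.sqrt_pos.2 (hρ0 v hv)).ne'
  rw [isFlatOn_congr hV (g' := fun v => Matrix.diagonal fun i => confComp a _ i v)
    (fun v hv => smul_metric_eq (hA.pos v (hVU hv)) (hM v (hVU hv)) (by
      show _ = ρ v * (M b v / √(ρ v)) ^ 2
      have := (hρ0 v hv).ne'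
      rw [div_pow, Real.sq_sqrt (hρ0 v hv).le]
      field_simp)), isFlatOn_confComp_iff hAV hψ] at hflat
  exact cotton_eq_zero hAV hψ hflat.1 hflat.2 huV hij hik hjk

/-- The flat metric `ψ⁻² ĝ` near `u₀` comes from the potentials `coneFun` based at a point that
differs from `u₀` in one coordinate only, so that `ψ(u₀)` reduces to a single nonzero term. -/
theorem isConformallyFlatOn_of_isQuadraticOn (hA : Admissible a U)
    (hb : ∀ u ∈ U, ∀ i, ContDiffAt ℝ ∞ (b i) (u i)) (hM : ∀ u ∈ U, M b u ≠ 0)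
    (hq : IsQuadraticOn a U m n p) : IsConformallyFlatOn (metric a b) U := by
  intro u₀ hu₀
  -- a base point `v ≠ u₀`
  obtain ⟨s, hsU, hsE, hs⟩ : ∃ s, Function.update u₀ 0 s ∈ U ∧
      0 < m 0 * u₀ 0 * s + n 0 * (u₀ 0 + s) + p 0 ∧ s ≠ u₀ 0 := by
    have h1 : ∀ᶠ s in 𝓝 (u₀ 0), Function.update u₀ 0 s ∈ U := by
      have hc : Continuous fun s => Function.update u₀ 0 s := continuous_const.update 0 continuous_id
      exact hc.continuousAt.eventually_mem (by simpa using hA.isOpen.mem_nhds hu₀)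
    have h2 : ∀ᶠ s in 𝓝 (u₀ 0), 0 < m 0 * u₀ 0 * s + n 0 * (u₀ 0 + s) + p 0 := by
      have hc : Continuous fun s : ℝ => m 0 * u₀ 0 * s + n 0 * (u₀ 0 + s) + p 0 := by fun_prop
      refine hc.continuousAt.eventually_mem (Ioi_mem_nhds ?_)
      have := hA.pos u₀ hu₀ 0
      rw [hq.2.2.2 u₀ hu₀ 0] at this
      linarith
    obtain ⟨s, ⟨hs1, hs2⟩, hs3⟩ := (((h1.and h2).filter_mono nhdsWithin_le_nhds).and
      (self_mem_nhdsWithin : {u₀ 0}ᶜ ∈ 𝓝[≠] (u₀ 0))).exists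
    exact ⟨s, hs1, hs2, hs3⟩
  set v := Function.update u₀ 0 s with hv
  have hv0 : v 0 = s := by simp [hv]
  have hv1 : v 1 = u₀ 1 := by simp [hv]
  have hv2 : v 2 = u₀ 2 := by simp [hv]
  set E : Fin 3 → ℝ → ℝ := fun i t =>
    √(a i t) * √(a i (v i)) + (m i * t * v i + n i * (t + v i) + p i)
  have hE0 : ∀ i, 0 < E i (u₀ i) := by
    have hpol : ∀ i, v i = u₀ i → 0 < m i * u₀ i * v i + n i * (u₀ i + v i) + p i := by
      intro i hi
      have := hA.pos u₀ hu₀ i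
      rw [hq.2.2.2 u₀ hu₀ i] at this
      rw [hi]
      linarith
    have hpol' : ∀ i, 0 < m i * u₀ i * v i + n i * (u₀ i + v i) + p i := by
      intro i
      fin_cases i
      · simpa [hv0] using hsE
      · exact hpol 1 hv1
      · exact hpol 2 hv2
    exact fun i => add_pos_of_nonneg_of_pos (by positivity) (hpol' i)
  set B : Fin 3 → ℝ → ℝ := fun i =>
    coneFun (a i) (m i) (n i) (p i) (v i) (diffProd i v) with hB
  have hD : ∀ i, diffProd i v ≠ 0 := diffProd_ne_zero (hA.ne v hsU)
  have hBs : ∀ u ∈ U, (∀ i, 0 < E i (u i)) → ∀ i, ContDiffAt ℝ ∞ (B i) (u i) := fun u hu hEu i =>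
    smooth_coneFun (hA.smooth u hu i) (hA.pos u hu i) (hD i) (hEu i)
  have hM0 : M B u₀ ≠ 0 := by
    have hne := hA.ne u₀ hu₀
    have hx : ∀ i, v i = u₀ i → B i (u₀ i) = 0 := fun i hi => by simp [hB, coneFun, hi]
    rw [M, Fin.sum_univ_three, hx 1 hv1, hx 2 hv2, zero_div, zero_div, add_zero, add_zero]
    refine div_ne_zero (div_ne_zero (pow_ne_zero 2 ?_) (mul_ne_zero (hD 0) (hE0 0).ne'))
      (diffProd_ne_zero hne 0)
    rw [hv0]
    exact sub_ne_zero.2 hs.symm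
  -- a neighbourhood on which the construction makes sense
  have hnear : ∀ᶠ u in 𝓝 u₀, u ∈ U ∧ (∀ i, 0 < E i (u i)) ∧ M B u ≠ 0 := by
    refine (hA.isOpen.eventually_mem hu₀).and ((eventually_all.2 fun i => ?_).and ?_)
    · have hc : ContinuousAt (fun u : Fin 3 → ℝ => E i (u i)) u₀ := by
        have h1 : ContinuousAt (fun u : Fin 3 → ℝ => a i (u i)) u₀ :=
          (hA.smooth u₀ hu₀ i).continuousAt.comp (f := fun u : Fin 3 → ℝ => u i)
            (continuous_apply i).continuousAt
        exact ((Real.continuous_sqrt.continuousAt.comp h1).mul continuousAt_const).add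
          (by fun_prop)
      exact hc.eventually_mem (Ioi_mem_nhds (hE0 i))
    · exact (smooth_M (hA.ne u₀ hu₀) (hBs u₀ hu₀ hE0)).continuousAt.eventually_ne hM0
  obtain ⟨V, hVsub, hV, hu₀V⟩ := mem_nhds_iff.1 hnear
  have hVU : V ⊆ U := fun u hu => (hVsub hu).1
  have hAV : Admissible a V := ⟨hV, fun v hv => hA.ne v (hVU hv), fun v hv => hA.pos v (hVU hv),
    fun v hv => hA.smooth v (hVU hv)⟩
  have hqV : IsQuadraticOn a V m n p :=
    ⟨hq.1, hq.2.1, hq.2.2.1, fun u hu => hq.2.2.2 u (hVU hu)⟩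
  have hBV : ∀ u ∈ V, ∀ i, ContDiffAt ℝ ∞ (B i) (u i) :=
    fun u hu => hBs u (hVU hu) (hVsub hu).2.1
  have hMV : ∀ u ∈ V, M B u ≠ 0 := fun u hu => (hVsub hu).2.2
  have hw : ∀ u ∈ V, ∀ i, wronsk (a i) (B i) (u i)
      = (diffProd i v)⁻¹ * u i + -((diffProd i v)⁻¹ * v i) := fun u hu i =>
    wronsk_coneFun (hqV.eventually hV hu i) (hq.2.2.2 v hsU i) (hAV.smooth u hu i)
      (hAV.pos u hu i) (hA.pos v hsU i).le (hD i) ((hVsub hu).2.1 i)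
  have hQ : ∀ u ∈ V, ∀ i, quadForm (m i) (a i) (B i) (u i) = 0 := by
    intro u hu i
    have e1 := quadForm_relation (hqV.eventually hV hu i)
      (eventually_coord hV hu fun w hw' => hw w hw' i) (hAV.smooth u hu i) (hBV u hu i)
    have e2 := coneFun_relation (hqV.2.2.2 u hu i) (hq.2.2.2 v hsU i)
      (hAV.pos u hu i).le (hA.pos v hsU i).le (hD i) ((hVsub hu).2.1 i)
    have e3 : quadForm (m i) (a i) (B i) (u i) * a i (u i) = 0 := by
      linear_combination e1 - e2
    exact (mul_eq_zero.1 e3).resolve_right (hAV.pos u hu i).ne'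
  have h01 := sub_ne_zero.2 (hA.ne v hsU 0 1 (by decide))
  have h02 := sub_ne_zero.2 (hA.ne v hsU 0 2 (by decide))
  have h12 := sub_ne_zero.2 (hA.ne v hsU 1 2 (by decide))
  have d0 : diffProd 0 v = (v 0 - v 1) * (v 0 - v 2) :=
    diffProd_eq (by decide) (by decide) (by decide) v
  have d1 : diffProd 1 v = -(v 0 - v 1) * (v 1 - v 2) := by
    rw [diffProd_eq (j := 0) (k := 2) (by decide) (by decide) (by decide) v]; ring
  have d2 : diffProd 2 v = (v 0 - v 2) * (v 1 - v 2) := by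
    rw [diffProd_eq (j := 0) (k := 1) (by decide) (by decide) (by decide) v]; ring
  have hflat := isFlatOn_of_wronsk (α := fun i => (diffProd i v)⁻¹)
    (β := fun i => -((diffProd i v)⁻¹ * v i)) hAV hqV hBV hMV
    (by
      simp only [Fin.sum_univ_three]
      rw [d0, d1, d2]
      field_simp
      ring)
    (by
      simp only [Fin.sum_univ_three]
      rw [d0, d1, d2]
      field_simp
      ring) hw
    (fun u hu => Finset.sum_eq_zero fun i _ => hQ u hu i)
  refine ⟨V, hV, hu₀V, hVU, fun u => M b u ^ 2 / M B u ^ 2, fun u hu => ?_, fun u hu => ?_, ?_⟩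
  · exact (((smooth_M (hAV.ne u hu) (hb u (hVU hu))).pow 2).div
      ((smooth_M (hAV.ne u hu) (hBV u hu)).pow 2) (pow_ne_zero 2 (hMV u hu))).contDiffWithinAt
  · have h1 := hM u (hVU hu)
    have h2 := hMV u hu
    positivity
  · refine (isFlatOn_congr hV fun u hu => smul_metric_eq
      (ρ := fun u => M b u ^ 2 / M B u ^ 2) (ψ := M B) (hAV.pos u hu) (hM u (hVU hu)) ?_).2 hflat
    have h2 := hMV u hu
    field_simp

end ConformallyFlat

end DupinMetric

end

theorem theorem7
    (a b : Fin 3 → ℝ → ℝ) (U : Set (Fin 3 → ℝ))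
    (hUo : IsOpen U) (hUc : IsConnected U)
    (ha : ∀ u ∈ U, ∀ i, ContDiffAt ℝ ∞ (a i) (u i))
    (hb : ∀ u ∈ U, ∀ i, ContDiffAt ℝ ∞ (b i) (u i))
    (hne : ∀ u ∈ U, ∀ i j, i ≠ j → u i ≠ u j)
    (hpos : ∀ u ∈ U, ∀ i, 0 < a i (u i))
    (hM : ∀ u ∈ U, DupinMetric.M b u ≠ 0) :
    -- 1) the off-diagonal components of the Ricci tensor vanish
    (∀ u ∈ U, ∀ i j, i ≠ j → LocalRiemann.ricci (DupinMetric.metric a b) i j u = 0) ∧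
    -- 2) the criterion of conformal flatness
    (LocalRiemann.IsConformallyFlatOn (DupinMetric.metric a b) U ↔
      ∃ m n p : Fin 3 → ℝ, DupinMetric.IsQuadraticOn a U m n p) ∧
    -- 3) the criterion of flatness
    (LocalRiemann.IsFlatOn (DupinMetric.metric a b) U ↔
      LocalRiemann.IsConformallyFlatOn (DupinMetric.metric a b) U ∧
      ∃ m n p : Fin 3 → ℝ, DupinMetric.IsQuadraticOn a U m n p ∧
        ∃ α β γ : Fin 3 → ℝ, (∑ i, α i = 0) ∧ (∑ i, β i = 0) ∧ (∑ i, γ i = 0) ∧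
          ∀ i,
            (∀ u ∈ U,
              (n i ^ 2 - m i * p i) * b i (u i) ^ 2
                + 2 * ((β i * m i - α i * n i) * u i + β i * n i - α i * p i) * b i (u i)
                + (α i * u i + β i) ^ 2 + γ i * a i (u i) = 0) ∧
            -- if the identity above does not involve `b i` at all, `b i` is restricted as follows
            (n i ^ 2 - m i * p i = 0 → β i * m i - α i * n i = 0 → β i * n i - α i * p i = 0 →
              ∀ u ∈ U, a i (u i) * deriv (b i) (u i) - deriv (a i) (u i) * b i (u i) / 2
                = α i * u i + β i)) := by
  have hA : DupinMetric.Admissible a U := ⟨hUo, hne, hpos, ha⟩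
  have hψ : DupinMetric.SmoothUnit (DupinMetric.M b) U :=
    ⟨fun u hu => DupinMetric.smooth_M (hne u hu) (hb u hu), hM⟩
  have hmetric : ∀ u ∈ U, DupinMetric.metric a b u
      = Matrix.diagonal fun i => DupinMetric.confComp a (DupinMetric.M b) i u := fun u hu => by
    simpa using DupinMetric.smul_metric_eq (ρ := fun _ => 1) (hpos u hu) (hM u hu) (by simp)
  have hconf : LocalRiemann.IsConformallyFlatOn (DupinMetric.metric a b) U ↔
      ∃ m n p : Fin 3 → ℝ, DupinMetric.IsQuadraticOn a U m n p :=
    ⟨fun h => DupinMetric.exists_isQuadraticOn hA hUc fun u hu i j k hij hik hjk =>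
      DupinMetric.cotton_of_isConformallyFlatOn hA hb hM h hu hij hik hjk,
    fun ⟨m, n, p, hq⟩ => DupinMetric.isConformallyFlatOn_of_isQuadraticOn hA hb hM hq⟩
  refine ⟨fun u hu i j hij => ?_, hconf, ?_⟩
  · obtain ⟨k, hik, hjk⟩ : ∃ k : Fin 3, i ≠ k ∧ j ≠ k := by revert i j; decide
    simp only [LocalRiemann.ricci, LocalRiemann.riemann_congr hUo hmetric hu]
    rw [← LocalRiemann.ricci, LocalRiemann.ricci_diagonal_offDiag hUo
      (fun v hv => DupinMetric.confComp_ne_zero (hne v hv) (hpos v hv) (hM v hv))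
      (fun v hv => DupinMetric.smooth_confComp (hne v hv) (hpos v hv) (ha v hv) (hψ.smooth v hv)
        (hM v hv)) hu hij hik hjk,
      DupinMetric.mixedCurv_confComp hA hψ hu hik.symm hjk.symm hij,
      DupinMetric.isEPDOn_M hUo hne hb u hu i j hij]
    simp
  · constructor
    · intro hflat
      have hcf := hflat.isConformallyFlatOn hUo
      obtain ⟨m, n, p, hq⟩ := hconf.1 hcf
      refine ⟨hcf, m, n, p, hq, ?_⟩
      rw [LocalRiemann.isFlatOn_congr hUo hmetric] at hflat
      obtain ⟨⟨α, β, hα, hβ, hw⟩, hQ⟩ := DupinMetric.wronsk_of_isFlatOn hA hUc hq hb hM hflat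
      obtain ⟨γ, hγ, hγQ⟩ := DupinMetric.exists_const_of_sum_eq_zero hUo hUc
        (fun u hu i => DupinMetric.smooth_quadForm (m i) (ha u hu i) (hb u hu i)) hQ
      refine ⟨α, β, γ, hα, hβ, hγ, fun i => ⟨fun u hu => ?_, fun _ _ _ u hu => hw u hu i⟩⟩
      rw [← hγQ u hu i]
      exact DupinMetric.quadForm_relation (hq.eventually hUo hu i)
        (LocalRiemann.eventually_coord hUo hu fun v hv => hw v hv i) (ha u hu i) (hb u hu i)
    · rintro ⟨-, m, n, p, hq, α, β, γ, hα, hβ, hγ, h⟩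
      rw [LocalRiemann.isFlatOn_congr hUo hmetric]
      have hw : ∀ u ∈ U, ∀ i, DupinMetric.wronsk (a i) (b i) (u i) = α i * u i + β i :=
        fun u hu i => DupinMetric.wronsk_of_quadratic_relation (hq.eventually hUo hu i)
          (ha u hu i) (LocalRiemann.eventually_coord hUo hu fun v hv => hb v hv i)
          (LocalRiemann.eventually_coord hUo hu fun v hv => (h i).1 v hv)
          (fun h1 h2 h3 => (h i).2 h1 h2 h3 u hu)
      refine DupinMetric.isFlatOn_of_wronsk hA hq hb hM hα hβ hw fun u hu => ?_
      rw [← hγ]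
      refine Finset.sum_congr rfl fun i _ => ?_
      have e := DupinMetric.quadForm_relation (hq.eventually hUo hu i)
        (LocalRiemann.eventually_coord hUo hu fun v hv => hw v hv i) (ha u hu i) (hb u hu i)
      exact mul_right_cancel₀ (hpos u hu i).ne' (by linear_combination e - (h i).1 u hu)
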